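/- Let $\mathrm{Conf}=2^{\mathbb Z_{\ge0}}$ be the space of all subsets (point configurations) of $\mathbb Z_{\ge0}$, with the product topology and its Borel $\sigma$-algebra. A Borel probability measure $P$ on $\mathrm{Conf}$ is called determinantal with correlation kernel $K:\mathbb Z_{\ge0}\times\mathbb Z_{\ge0}\to\mathbb R$ if $$P(\{X: x_1,\dots,x_k\in X\})=\det[K(x_i,x_j)]_{i,j=1}^k$$ for every finite set $\{x_1,\dots,x_k\}\subset\mathbb Z_{\ge0}$ of distinct points; such a $P$ is determined by $K$ if it exists. For $\beta>0$, $\xi\in(0,1)$ and $N\ge1$, the $N$-particle Meixner ensemble $\mathrm{Meixner}(N,\beta,\xi)$ is the determinantal measure whose kernel is the matrix of the orthogonal projection of $\ell^2(\mathbb Z_{\ge0})$ onto the span of the functions $x\mapsto W(x)^{1/2}x^n$, $0\le n\le N-1$, where $W(x)=\frac{(\beta)_x}{x!}\xi^x$ is the Meixner weight and $(\beta)_x=\beta(\beta+1)\cdots(\beta+x-1)$. For $r\in\mathbb R$, the discrete Hermite ensemble $\mathrm{DH}^+(r)$ is the determinantal measure with kernel $$K(x,y)=(\pi\,2^{x+y}x!\,y!)^{-1/2}\int_r^{+\infty}H_x(t)H_y(t)e^{-t^2}\,dt,\qquad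 x,y\in\mathbb Z_{\ge0},$$ where $H_n$ is the $n$th Hermite polynomial (orthogonal with weight $e^{-t^2}$ on $\mathbb R$, leading coefficient $2^n$). **Theorem.** Fix $r\in\mathbb R$. Let $(\beta_N)_{N\ge1}$ and $(\xi_N)_{N\ge1}$ be sequences with $\beta_N>0$ and $\xi_N\in(0,1)$ such that, as $N\to\infty$, $$\xi_N\beta_N\to+\infty,\qquad -\sqrt{\xi_N\beta_N}+\frac{(1-\xi_N)N}{\sqrt{\xi_N\beta_N}}\to-\sqrt2\,r.$$ Then the determinantal measures $\mathrm{Meixner}(N,\beta_N,\xi_N)$, $N\ge1$, and $\mathrm{DH}^+(r)$ exist and are unique, and $\mathrm{Meixner}(N,\beta_N,\xi_N)$ converges weakly to $\mathrm{DH}^+(r)$ as $N\to\infty$. -/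

import Mathlib

open MeasureTheory Filter Topology Polynomial
open scoped ENNReal Nat

noncomputable section

/-- Point configurations in `ℤ≥0`, i.e. subsets `X ⊆ ℕ` encoded by their indicator functions.
The topology is the product topology of discrete two-point spaces (compact, totally disconnected)
and the σ-algebra is its Borel σ-algebra. -/
abbrev Conf : Type := ℕ → Bool

/-- The cylinder set of all configurations that contain the finite set `Y`. -/
def cylinderSet (Y : Finset ℕ) : Set Conf := {X | ∀ y ∈ Y, X y = true}

/-- `P` is a determinantal measure with correlation kernel `K` (with respect to the counting
measure on `ℤ≥0`): for each finite set `Y = {x₁, …, x_k}`, the correlation function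
`ρ_k (x₁, …, x_k) = P (X ⊇ Y)` equals `det [K (x_i, x_j)]`. -/
def IsDeterminantal (K : ℕ → ℕ → ℝ) (P : ProbabilityMeasure Conf) : Prop :=
  ∀ Y : Finset ℕ,
    (P : Measure Conf).real (cylinderSet Y) =
      (Matrix.of fun i j : {x : ℕ // x ∈ Y} => K i j).det

/-- The determinantal measure `P_K` with correlation kernel `K`
(an arbitrary value if there is none). -/
def determinantalMeasure (K : ℕ → ℕ → ℝ) : ProbabilityMeasure Conf :=
  Classical.epsilon (IsDeterminantal K)

/-- The real Hilbert space `ℓ²(ℤ≥0)`. -/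
abbrev EllTwo : Type := lp (fun _ : ℕ => ℝ) 2

/-- The Meixner weight `W(x) = (β)_x ξ^x / x!`, where `(β)_x = β (β + 1) ⋯ (β + x - 1)`. -/
def meixnerWeight (β ξ : ℝ) (x : ℕ) : ℝ :=
  (ascPochhammer ℝ x).eval β / (x ! : ℝ) * ξ ^ x

/-- Polynomials of degree at most `N - 1`, as functions `x ↦ W(x)^{1/2} p(x)` on `ℤ≥0`. -/
def weightedPoly (W : ℕ → ℝ) (N : ℕ) : degreeLT ℝ N →ₗ[ℝ] (ℕ → ℝ) where
  toFun p := fun x => √(W x) * (p : ℝ[X]).eval (x : ℝ)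
  map_add' p q := by
    funext x
    simp [mul_add]
  map_smul' c p := by
    funext x
    simp
    ring

/-- Inclusion of `ℓ²(ℤ≥0)` in the space of all sequences. -/
def ellTwoIncl : EllTwo →ₗ[ℝ] (ℕ → ℝ) where
  toFun f := fun x => f x
  map_add' _ _ := rfl
  map_smul' _ _ := rfl

/-- The space `L_N` of polynomials of degree at most `N - 1` in `ℓ²(ℤ≥0, W)`, transferred to
`ℓ²(ℤ≥0)` by the isometry `f ↦ W^{1/2} f`. -/
def polySubspace (W : ℕ → ℝ) (N : ℕ) : Submodule ℝ EllTwo :=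
  (LinearMap.range (weightedPoly W N)).comap ellTwoIncl

instance polySubspace_finiteDimensional (W : ℕ → ℝ) (N : ℕ) :
    FiniteDimensional ℝ (polySubspace W N) := by
  have : FiniteDimensional ℝ (degreeLT ℝ N) := (degreeLTEquiv ℝ N).symm.finiteDimensional
  let g : polySubspace W N →ₗ[ℝ] LinearMap.range (weightedPoly W N) :=
    ellTwoIncl.restrict (fun _ hx => hx)
  refine Module.Finite.of_injective g (fun a b h => ?_)
  have h' : (g a : ℕ → ℝ) = g b := by rw [h]
  exact Subtype.ext (lp.ext h')

/-- The matrix `K_N (x, y)` of the orthogonal projection of `ℓ²(ℤ≥0)` onto `L_N`: the correlation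
kernel, with respect to the counting measure, of the `N`-particle orthogonal polynomial ensemble
with weight `W`. -/
def orthPolyKernel (W : ℕ → ℝ) (N : ℕ) (x y : ℕ) : ℝ :=
  ((polySubspace W N).starProjection (lp.single 2 y (1 : ℝ)) : EllTwo) x

/-- Correlation kernel of the `N`-particle Meixner ensemble. -/
def meixnerKernel (N : ℕ) (β ξ : ℝ) : ℕ → ℕ → ℝ :=
  orthPolyKernel (meixnerWeight β ξ) N

/-- The `N`-particle Meixner ensemble `Meixner(N, β, ξ)`. -/
def meixnerEnsemble (N : ℕ) (β ξ : ℝ) : ProbabilityMeasure Conf :=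
  determinantalMeasure (meixnerKernel N β ξ)

/-- The Hermite polynomials `H_n` with weight `exp (-t²)` and leading coefficient `2 ^ n`
(Mathlib's `Polynomial.hermite` is for the weight `exp (-t²/2)`), by the backward shift relation
`H_{n+1}(t) = 2 t H_n(t) - H_n'(t)`. -/
def hermiteH : ℕ → ℝ[X]
  | 0 => 1
  | n + 1 => 2 * X * hermiteH n - derivative (hermiteH n)

/-- The discrete Hermite kernel of `DH⁺(r)`. -/
def discreteHermiteKernel (r : ℝ) (x y : ℕ) : ℝ :=
  (√(Real.pi * 2 ^ (x + y) * (x ! : ℝ) * (y ! : ℝ)))⁻¹ *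
    ∫ t in Set.Ioi r, (hermiteH x).eval t * (hermiteH y).eval t * Real.exp (-t ^ 2)

/-- The discrete Hermite ensemble `DH⁺(r)`. -/
def discreteHermiteEnsemble (r : ℝ) : ProbabilityMeasure Conf :=
  determinantalMeasure (discreteHermiteKernel r)

end

/-! ### Determinantal measures: uniqueness, compactness, existence -/

/-! Cylinder events are clopen and `Conf` is compact, so pointwise convergence of kernels forces
weak convergence of determinantal measures (`exists_isDeterminantal_of_tendsto`). The limit itself
is produced by compactness, which also gives the existence of DH⁺(r). Meixner ensembles exist
because 2P - 1 is an isometry for a projection P, and this makes all finite inclusion-exclusion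
weights nonnegative.

The kernels converge thanks to self-duality of Meixner polynomials, M_n(x) = M_x(n)
(`meixnerVal_comm`). Exchanging degree and variable turns the kernel, a sum over degrees n < N, into
an integral over n < N of two orthonormal polynomials of fixed degrees x and y against a negative
binomial law in n (`meixnerKernel_eq_setIntegral`). In the variable z = ((1-ξ)n - ξβ)/√(ξβ) the
domain is z < c_N with c_N → -√2 r. The law of z tends to the standard Gaussian, and the polynomials
tend to normalized Hermite polynomials in -z/√2 because their recurrence coefficients converge. The
limiting integral is the discrete Hermite kernel after the substitution z = -√2 t.

The Gaussian limit and the uniform moment bounds both come from a Stein identity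
(`integral_meixnerLaw_stein`). A factor 1-ξ cancels from each estimate, so ξβ → ∞ suffices without
any convergence of ξ. Bounded moments and the absence of Gaussian atoms then upgrade weak
convergence to convergence of truncated moments (`tendsto_setIntegral_pow`). -/

theorem isClopen_cylinderSet (Y : Finset ℕ) : IsClopen (cylinderSet Y) := by
  have h : cylinderSet Y = ⋂ y ∈ Y, (fun X : Conf => X y) ⁻¹' {true} := by
    ext X; simp [cylinderSet]
  rw [h]
  exact Y.finite_toSet.isClopen_biInter fun y _ =>
    (isClopen_discrete ({true} : Set Bool)).preimage (continuous_apply y)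

theorem cylinderSet_union (Y Z : Finset ℕ) :
    cylinderSet (Y ∪ Z) = cylinderSet Y ∩ cylinderSet Z := by
  ext X
  simp only [cylinderSet, Finset.mem_union, Set.mem_ofPred_eq, Set.mem_inter_iff]
  exact ⟨fun h => ⟨fun y hy => h y (.inl hy), fun y hy => h y (.inr hy)⟩,
    fun h y hy => hy.elim (h.1 y) (h.2 y)⟩

theorem isPiSystem_range_cylinderSet : IsPiSystem (Set.range cylinderSet) := by
  rintro _ ⟨Y, rfl⟩ _ ⟨Z, rfl⟩ _
  exact ⟨Y ∪ Z, cylinderSet_union Y Z⟩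

theorem generateFrom_range_cylinderSet :
    (inferInstance : MeasurableSpace Conf) =
      MeasurableSpace.generateFrom (Set.range cylinderSet) := by
  apply le_antisymm
  · refine iSup_le fun x => ?_
    rw [← measurable_iff_comap_le]
    refine @measurable_to_bool _ (MeasurableSpace.generateFrom (Set.range cylinderSet)) _ ?_
    refine MeasurableSpace.measurableSet_generateFrom ⟨{x}, ?_⟩
    ext X; simp [cylinderSet]
  · refine MeasurableSpace.generateFrom_le ?_
    rintro _ ⟨Y, rfl⟩
    exact (isClopen_cylinderSet Y).1.measurableSet

theorem IsDeterminantal.unique {K : ℕ → ℕ → ℝ} {P Q : ProbabilityMeasure Conf}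
    (hP : IsDeterminantal K P) (hQ : IsDeterminantal K Q) : P = Q := by
  refine Subtype.ext (ext_of_generate_finite (μ := (P : Measure Conf)) (ν := (Q : Measure Conf)) _
    generateFrom_range_cylinderSet isPiSystem_range_cylinderSet ?_ (by simp))
  rintro _ ⟨Y, rfl⟩
  have h := (hP Y).trans (hQ Y).symm
  exact (measureReal_eq_measureReal_iff).1 h

theorem IsDeterminantal.determinantalMeasure_eq {K : ℕ → ℕ → ℝ} {P : ProbabilityMeasure Conf}
    (hP : IsDeterminantal K P) : determinantalMeasure K = P :=
  IsDeterminantal.unique (Classical.epsilon_spec (p := IsDeterminantal K) ⟨P, hP⟩) hP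

theorem continuous_measureReal_cylinderSet (Y : Finset ℕ) :
    Continuous fun P : ProbabilityMeasure Conf => (P : Measure Conf).real (cylinderSet Y) := by
  refine continuous_iff_continuousAt.2 fun P => ?_
  have h := ProbabilityMeasure.tendsto_measure_of_isClopen_of_tendsto
    (μs := fun Q : ProbabilityMeasure Conf => Q) (L := 𝓝 P) (μ := P) tendsto_id
    (isClopen_cylinderSet Y)
  exact (NNReal.continuous_coe.tendsto _).comp h

/-- If the correlation functions of a sequence of probability measures converge to the
determinants of `K`, then the measures converge weakly to a determinantal measure of kernel `K`. -/
theorem exists_isDeterminantal_of_tendsto {K : ℕ → ℕ → ℝ} (P : ℕ → ProbabilityMeasure Conf)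
    (h : ∀ Y : Finset ℕ, Tendsto (fun n => (P n : Measure Conf).real (cylinderSet Y)) atTop
      (𝓝 (Matrix.of fun i j : {x : ℕ // x ∈ Y} => K i j).det)) :
    ∃ Q, IsDeterminantal K Q ∧ Tendsto P atTop (𝓝 Q) := by
  -- Every cluster point has the limiting correlation functions, hence is the unique determinantal
  -- measure; in a compact space a unique cluster point is a limit.
  have key : ∀ Q, MapClusterPt Q atTop P → IsDeterminantal K Q := by
    intro Q hQ Y
    have h1 := hQ.continuousAt_comp (continuous_measureReal_cylinderSet Y).continuousAt
    have h2 : ClusterPt ((Q : Measure Conf).real (cylinderSet Y)) (𝓝 _) := h1.clusterPt.mono (h Y)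
    exact eq_of_nhds_neBot h2
  obtain ⟨Q, hQ⟩ := exists_clusterPt_of_compactSpace (map P atTop)
  refine ⟨Q, key Q hQ, ?_⟩
  refine isCompact_univ.tendsto_nhds_of_unique_mapClusterPt (by simp) fun R _ hR => ?_
  exact (key R hR).unique (key Q hQ)

theorem tendsto_det_of_tendsto {K : ℕ → ℕ → ℝ} {Kn : ℕ → ℕ → ℕ → ℝ}
    (h : ∀ x y, Tendsto (fun n => Kn n x y) atTop (𝓝 (K x y))) (Y : Finset ℕ) :
    Tendsto (fun n => (Matrix.of fun i j : {x : ℕ // x ∈ Y} => Kn n i j).det) atTop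
      (𝓝 (Matrix.of fun i j : {x : ℕ // x ∈ Y} => K i j).det) := by
  have hc : Continuous fun M : Matrix {x : ℕ // x ∈ Y} {x : ℕ // x ∈ Y} ℝ => M.det :=
    Continuous.matrix_det continuous_id
  refine (hc.tendsto _).comp ?_
  exact tendsto_pi_nhds.2 fun i => tendsto_pi_nhds.2 fun j => h i j

/-! ### Determinantal processes on a finite set. -/

section FiniteWeights

variable {ι : Type*} [Fintype ι] [DecidableEq ι]

/-- The probability that a determinantal point process with kernel `K` on a finite set equals
`A`. -/
noncomputable def finiteWeight (K : Matrix ι ι ℝ) (A : Finset ι) : ℝ :=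
  Matrix.det (Matrix.of (A.piecewise (fun i => K i) (fun i => (1 : Matrix ι ι ℝ) i - K i)))

/-- Inclusion-exclusion by multilinearity in the rows. Row i splits as K_i + (1 - K)_i = e_i off Y
and as K_i + 0 on Y; terms not containing Y vanish, and the unexpanded matrix is block triangular
with an identity block off Y. -/
theorem sum_finiteWeight (K : Matrix ι ι ℝ) (Y : Finset ι) :
    ∑ A with Y ⊆ A, finiteWeight K A = (K.submatrix ((↑) : {x // x ∈ Y} → ι) (↑)).det := by
  set m : ι → ι → ℝ := fun i => K i
  set m' : ι → ι → ℝ := fun i => if i ∈ Y then 0 else (1 : Matrix ι ι ℝ) i - K i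
  have h := (Matrix.detRowAlternating (R := ℝ) (n := ι)).toMultilinearMap.map_add_univ m m'
  have h2 : (Matrix.of (m + m')).det = (K.submatrix ((↑) : {x // x ∈ Y} → ι) (↑)).det := by
    rw [Matrix.twoBlockTriangular_det (Matrix.of (m + m')) (fun i => i ∈ Y)]
    · have h1 : (Matrix.toSquareBlockProp (Matrix.of (m + m')) fun i => i ∉ Y) = 1 := by
        ext i j
        simp [Matrix.toSquareBlockProp, m, m', i.2, Matrix.one_apply, Subtype.ext_iff]
      have h2 : (Matrix.toSquareBlockProp (Matrix.of (m + m')) fun i => i ∈ Y) =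
          K.submatrix ((↑) : {x // x ∈ Y} → ι) (↑) := by
        ext i j
        simp [Matrix.toSquareBlockProp, m, m']
      rw [h1, h2, Matrix.det_one, mul_one]
      congr!
    · intro i hi j hj
      have : i ≠ j := fun h => hi (h ▸ hj)
      simp [m, m', hi, this]
  rw [← h2]
  refine Eq.trans ?_ h.symm
  rw [Finset.sum_filter]
  refine Finset.sum_congr rfl fun A _ => ?_
  split_ifs with hA
  · change _ = Matrix.det (Matrix.of (A.piecewise m m'))
    unfold finiteWeight
    congr 2
    funext i
    by_cases hi : i ∈ A
    · simp [hi, m]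
    · have : i ∉ Y := fun h => hi (hA h)
      simp [hi, m', this]
  · obtain ⟨i, hiY, hiA⟩ := Finset.not_subset.1 hA
    exact ((Matrix.detRowAlternating (R := ℝ) (n := ι)).toMultilinearMap.map_coord_zero i
      (by simp [hiA, m', hiY])).symm

/-- The determinant of 1 + tB is 1 at t = 0. Were it negative at t = 1, it would vanish at some 0 ≤
t < 1, giving v = -tBv with v ≠ 0, impossible for a contraction B. -/
theorem det_one_add_nonneg (B : Matrix ι ι ℝ)
    (hB : ∀ v : ι → ℝ, ∑ i, (B.mulVec v i) ^ 2 ≤ ∑ i, v i ^ 2) : 0 ≤ (1 + B).det := by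
  by_contra! hneg
  have hc : Continuous fun t : ℝ => (1 + t • B).det := by
    apply Continuous.matrix_det; fun_prop
  obtain ⟨t, ⟨ht0, ht1⟩, ht⟩ := intermediate_value_Icc' (zero_le_one' ℝ) hc.continuousOn
    (show (0 : ℝ) ∈ Set.Icc ((1 + (1 : ℝ) • B).det) ((1 + (0 : ℝ) • B).det) by
      simp [hneg.le])
  obtain ⟨v, hv, hv0⟩ := Matrix.exists_mulVec_eq_zero_iff.2 ht
  have h1 : ∀ i, v i = -(t * B.mulVec v i) := fun i => by
    have := congrFun hv0 i
    simp only [Matrix.add_mulVec, Matrix.one_mulVec, Matrix.smul_mulVec, Pi.add_apply,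
      Pi.smul_apply, smul_eq_mul, Pi.zero_apply] at this
    linarith
  have hpos : 0 < ∑ i, v i ^ 2 := by
    obtain ⟨i, hi⟩ := Function.ne_iff.1 hv
    exact Finset.sum_pos' (fun _ _ => sq_nonneg _) ⟨i, Finset.mem_univ _, by
      have : v i ≠ 0 := hi
      positivity⟩
  have h2 : ∑ i, v i ^ 2 = t ^ 2 * ∑ i, (B.mulVec v i) ^ 2 := by
    rw [Finset.mul_sum]
    exact Finset.sum_congr rfl fun i _ => by rw [h1 i]; ring
  have h3 : t ≠ 1 := by
    rintro rfl
    simp at ht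
    linarith
  have h4 : t ^ 2 < 1 := by
    have := lt_of_le_of_ne ht1 h3
    nlinarith
  nlinarith [hB v, sq_nonneg t]

/-- The matrix defining the weight is (1 + S(2K - 1))/2, where S is the diagonal of signs, +1 on A
and -1 off A; S preserves the norm, so S(2K - 1) is a contraction. -/
theorem finiteWeight_nonneg (K : Matrix ι ι ℝ)
    (hK : ∀ v : ι → ℝ, ∑ i, (2 * K.mulVec v i - v i) ^ 2 ≤ ∑ i, v i ^ 2) (A : Finset ι) :
    0 ≤ finiteWeight K A := by
  set s : ι → ℝ := fun i => if i ∈ A then 1 else -1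
  set B : Matrix ι ι ℝ := Matrix.of fun i j => s i * (2 * K i j - (1 : Matrix ι ι ℝ) i j)
  have h1 : Matrix.of (A.piecewise (fun i => K i) (fun i => (1 : Matrix ι ι ℝ) i - K i)) =
      (1 / 2 : ℝ) • (1 + B) := by
    ext i j
    by_cases hi : i ∈ A
    · simp [hi, B, s]
    · simp [hi, B, s]; ring
  rw [finiteWeight, h1, Matrix.det_smul]
  refine mul_nonneg (by positivity) (det_one_add_nonneg _ fun v => ?_)
  refine le_trans (Finset.sum_le_sum fun i _ => le_of_eq ?_) (hK v)
  have hs : s i ^ 2 = 1 := by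
    by_cases hi : i ∈ A <;> simp [s, hi]
  have : B.mulVec v i = s i * (2 * K.mulVec v i - v i) := by
    simp only [Matrix.mulVec, dotProduct, B, Matrix.of_apply]
    rw [Finset.mul_sum]
    have : v i = ∑ j, (1 : Matrix ι ι ℝ) i j * v j := by
      have := congrFun (Matrix.one_mulVec v) i
      exact this.symm
    conv_rhs => rw [this]
    rw [← Finset.sum_sub_distrib, Finset.mul_sum]
    exact Finset.sum_congr rfl fun j _ => by ring
  rw [this, mul_pow, hs, one_mul]

end FiniteWeights

/-! ### Existence on the whole half-line. -/

theorem exists_measure_of_finite {K : ℕ → ℕ → ℝ} (F : Finset ℕ)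
    (hK : ∀ v : {x // x ∈ F} → ℝ,
      ∑ i : {x // x ∈ F}, (2 * ∑ j : {x // x ∈ F}, K i j * v j - v i) ^ 2 ≤ ∑ i, v i ^ 2) :
    ∃ P : ProbabilityMeasure Conf, ∀ Y ⊆ F, (P : Measure Conf).real (cylinderSet Y) =
      (Matrix.of fun i j : {x : ℕ // x ∈ Y} => K i j).det := by
  set M : Matrix {x // x ∈ F} {x // x ∈ F} ℝ := Matrix.of fun i j => K i j
  have hnn : ∀ A, 0 ≤ finiteWeight M A := finiteWeight_nonneg M hK
  set c : Finset {x // x ∈ F} → Conf :=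
    fun A x => decide (x ∈ A.map (Function.Embedding.subtype _))
  set μ : Measure Conf := ∑ A, ENNReal.ofReal (finiteWeight M A) • Measure.dirac (c A)
  have hdet : ∀ Y ⊆ F, (Matrix.of fun i j : {x : ℕ // x ∈ Y} => K i j).det =
      ∑ A with Y.subtype (· ∈ F) ⊆ A, finiteWeight M A := by
    intro Y hY
    rw [sum_finiteWeight]
    let e : {x : ℕ // x ∈ Y} ≃ {x // x ∈ Y.subtype (· ∈ F)} :=
      { toFun := fun x => ⟨⟨x, hY x.2⟩, by simp⟩
        invFun := fun x => ⟨x.1.1, Finset.mem_subtype.1 x.2⟩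
        left_inv := fun _ => rfl
        right_inv := fun _ => rfl }
    rw [← Matrix.det_submatrix_equiv_self e]
    rfl
  have hμ : ∀ Y ⊆ F, μ (cylinderSet Y) = ENNReal.ofReal
      (Matrix.of fun i j : {x : ℕ // x ∈ Y} => K i j).det := by
    intro Y hY
    have hmem : ∀ A, c A ∈ cylinderSet Y ↔ Y.subtype (· ∈ F) ⊆ A := by
      intro A
      simp only [c, cylinderSet, Set.mem_ofPred_eq, decide_eq_true_eq, Finset.mem_map,
        Function.Embedding.subtype_apply, Finset.subset_iff, Finset.mem_subtype]
      constructor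
      · rintro h ⟨x, hx⟩ hxY
        obtain ⟨a, ha, rfl⟩ := h x hxY
        exact ha
      · exact fun h y hy => ⟨⟨y, hY hy⟩, h hy, rfl⟩
    rw [hdet Y hY, ENNReal.ofReal_sum_of_nonneg fun A _ => hnn A, Finset.sum_filter]
    simp only [μ, Measure.coe_finsetSum, Finset.sum_apply, Measure.smul_apply, smul_eq_mul]
    refine Finset.sum_congr rfl fun A _ => ?_
    rw [Measure.dirac_apply' _ (isClopen_cylinderSet Y).1.measurableSet]
    by_cases h : Y.subtype (· ∈ F) ⊆ A
    · simp [h, (hmem A).2 h]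
    · have : c A ∉ cylinderSet Y := fun h' => h ((hmem A).1 h')
      simp [h, this]
  have hprob : IsProbabilityMeasure μ := by
    constructor
    -- The total mass is the correlation function of the empty set, an empty determinant.
    have := hμ ∅ (by simp)
    have h2 : cylinderSet ∅ = Set.univ := by ext; simp [cylinderSet]
    rw [h2] at this
    simp [this]
  refine ⟨⟨μ, hprob⟩, fun Y hY => ?_⟩
  change (μ (cylinderSet Y)).toReal = _
  rw [hμ Y hY, ENNReal.toReal_ofReal]
  rw [hdet Y hY]
  exact Finset.sum_nonneg fun A _ => hnn A

/-- The measures built on {0, …, n-1} have correlation functions that are eventually constant in n,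
so compactness replaces a consistency and extension argument. -/
theorem exists_isDeterminantal_of_contraction {K : ℕ → ℕ → ℝ}
    (hK : ∀ (F : Finset ℕ) (v : {x // x ∈ F} → ℝ),
      ∑ i : {x // x ∈ F}, (2 * ∑ j : {x // x ∈ F}, K i j * v j - v i) ^ 2 ≤ ∑ i, v i ^ 2) :
    ∃ P : ProbabilityMeasure Conf, IsDeterminantal K P := by
  choose P hP using fun n => exists_measure_of_finite (Finset.range n) (hK (Finset.range n))
  obtain ⟨Q, hQ, -⟩ := exists_isDeterminantal_of_tendsto (K := K) P fun Y => by
    refine tendsto_const_nhds.congr' ?_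
    obtain ⟨n, hn⟩ := Y.exists_nat_subset_range
    filter_upwards [eventually_ge_atTop n] with m hm
    exact (hP m Y (hn.trans (Finset.range_mono hm))).symm
  exact ⟨Q, hQ⟩

/-- The reflection 2P - 1 preserves the norm, so its compression to finitely many coordinates is a
contraction. No property of the weight is needed. -/
theorem exists_isDeterminantal_orthPolyKernel (W : ℕ → ℝ) (N : ℕ) :
    ∃ P : ProbabilityMeasure Conf, IsDeterminantal (orthPolyKernel W N) P := by
  refine exists_isDeterminantal_of_contraction fun F v => ?_
  set u : EllTwo := ∑ j : {x // x ∈ F}, v j • lp.single 2 (j : ℕ) (1 : ℝ)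
  have hu : ∀ i : {x // x ∈ F}, u i = v i := by
    intro i
    simp only [u, lp.coeFn_sum, Finset.sum_apply, lp.coeFn_smul, Pi.smul_apply, lp.coeFn_single,
      smul_eq_mul, Pi.single_apply, mul_ite, mul_one, mul_zero, Subtype.coe_inj]
    simp
  have hu0 : ∀ i ∉ F, u i = 0 := by
    intro i hi
    simp only [u, lp.coeFn_sum, Finset.sum_apply, lp.coeFn_smul, Pi.smul_apply, lp.coeFn_single,
      smul_eq_mul, Pi.single_apply, mul_ite, mul_one, mul_zero]
    refine Finset.sum_eq_zero fun j _ => if_neg ?_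
    rintro rfl
    exact hi j.2
  have hPu : ∀ i : ℕ, (polySubspace W N).starProjection u i =
      ∑ j : {x // x ∈ F}, orthPolyKernel W N i j * v j := by
    intro i
    simp only [u, map_sum, map_smul, lp.coeFn_sum, Finset.sum_apply, lp.coeFn_smul,
      Pi.smul_apply, smul_eq_mul, orthPolyKernel, mul_comm (v _)]
  set R := (polySubspace W N).reflection u
  have hR : ∀ i : {x // x ∈ F}, R i =
      2 * ∑ j : {x // x ∈ F}, orthPolyKernel W N i j * v j - v i := by
    intro i
    rw [← hPu, ← hu]
    simp [R, Submodule.reflection_apply, two_mul, two_smul]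
  have hnR : ‖R‖ = ‖u‖ := by simp [R]
  have hnorm : ∀ f : EllTwo, HasSum (fun i => f i ^ 2) (‖f‖ ^ 2) := fun f => by
    have := lp.hasSum_inner (𝕜 := ℝ) f f
    rw [real_inner_self_eq_norm_sq] at this
    simpa [sq] using this
  have hnu : ‖u‖ ^ 2 = ∑ i, v i ^ 2 := by
    have h1 : HasSum (fun i => u i ^ 2) (∑ i ∈ F, u i ^ 2) :=
      hasSum_sum_of_ne_finset_zero fun i hi => by simp [hu0 i hi]
    rw [(hnorm u).unique h1, ← Finset.sum_coe_sort]
    exact Finset.sum_congr rfl fun i _ => by rw [hu]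
  rw [← hnu, ← hnR]
  simp_rw [← hR]
  rw [Finset.sum_coe_sort F fun i => R i ^ 2]
  exact sum_le_hasSum _ (fun _ _ => sq_nonneg _) (hnorm R)

/-! ### The Meixner weight -/

section Meixner

variable {β ξ : ℝ}

theorem meixnerWeight_pos (hβ : 0 < β) (hξ : 0 < ξ) (x : ℕ) : 0 < meixnerWeight β ξ x := by
  have := ascPochhammer_pos x β hβ
  unfold meixnerWeight
  positivity

theorem meixnerWeight_succ (β ξ : ℝ) (x : ℕ) :
    meixnerWeight β ξ (x + 1) * (x + 1) = ξ * (x + β) * meixnerWeight β ξ x := by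
  have h : ((x ! : ℕ) : ℝ) ≠ 0 := by positivity
  have h' : (x : ℝ) + 1 ≠ 0 := by positivity
  simp only [meixnerWeight, ascPochhammer_succ_eval, Nat.factorial_succ, Nat.cast_mul,
    Nat.cast_succ, pow_succ]
  field_simp
  ring

theorem summable_pow_mul_meixnerWeight (hβ : 0 < β) (hξ : 0 < ξ) (hξ1 : ξ < 1) (k : ℕ) :
    Summable fun x : ℕ => (x + 1 : ℝ) ^ k * meixnerWeight β ξ x := by
  have hpos : ∀ x : ℕ, 0 < (x + 1 : ℝ) ^ k * meixnerWeight β ξ x := fun x =>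
    mul_pos (by positivity) (meixnerWeight_pos hβ hξ x)
  refine summable_of_ratio_test_tendsto_lt_one hξ1 (.of_forall fun x => (hpos x).ne') ?_
  have hinv : Tendsto (fun x : ℕ => ((x : ℝ) + 1)⁻¹) atTop (𝓝 0) := by
    simpa using tendsto_one_div_add_atTop_nhds_zero_nat (𝕜 := ℝ)
  have h1 : Tendsto (fun x : ℕ => (1 + ((x : ℝ) + 1)⁻¹) ^ k *
      (ξ * (1 + (β - 1) * ((x : ℝ) + 1)⁻¹)))
      atTop (𝓝 ((1 + 0) ^ k * (ξ * (1 + (β - 1) * 0)))) :=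
    ((hinv.const_add 1).pow k).mul (((hinv.const_mul (β - 1)).const_add 1).const_mul ξ)
  simp only [add_zero, one_pow, mul_zero, mul_one, one_mul] at h1
  refine h1.congr fun x => ?_
  rw [Real.norm_of_nonneg (hpos _).le, Real.norm_of_nonneg (hpos _).le, eq_div_iff (hpos x).ne']
  have hx : (x : ℝ) + 1 ≠ 0 := by positivity
  have h2 : meixnerWeight β ξ (x + 1) = ξ * (x + β) * meixnerWeight β ξ x / (x + 1) := by
    rw [eq_div_iff hx, meixnerWeight_succ]
  have h3 : 1 + ((x : ℝ) + 1)⁻¹ = (x + 1 + 1) / (x + 1) := by field_simp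
  have h4 : 1 + (β - 1) * ((x : ℝ) + 1)⁻¹ = (x + β) / (x + 1) := by field_simp; ring
  rw [h2, h3, h4, div_pow]
  push_cast
  field_simp

theorem summable_meixnerWeight_mul_eval (hβ : 0 < β) (hξ : 0 < ξ) (hξ1 : ξ < 1) (p : ℝ[X]) :
    Summable fun x : ℕ => meixnerWeight β ξ x * p.eval (x : ℝ) := by
  induction p using Polynomial.induction_on' with
  | add p q hp hq => simpa [mul_add] using hp.add hq
  | monomial k a =>
    refine ((summable_pow_mul_meixnerWeight hβ hξ hξ1 k).mul_left |a|).of_norm_bounded fun x => ?_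
    have h1 : (x : ℝ) ^ k ≤ (x + 1) ^ k := by gcongr; linarith
    have h2 := (meixnerWeight_pos hβ hξ x).le
    rw [eval_monomial, norm_mul, norm_mul, Real.norm_of_nonneg h2, Real.norm_eq_abs,
      Real.norm_of_nonneg (by positivity)]
    calc _ = |a| * (x ^ k * meixnerWeight β ξ x) := by ring
      _ ≤ _ := by gcongr

/-- Summation of polynomials against the Meixner weight. -/
noncomputable def meixnerSum (β ξ : ℝ) (p : ℝ[X]) : ℝ :=
  ∑' x : ℕ, meixnerWeight β ξ x * p.eval (x : ℝ)

theorem meixnerSum_congr {p q : ℝ[X]} (h : ∀ x : ℕ, p.eval (x : ℝ) = q.eval (x : ℝ)) :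
    meixnerSum β ξ p = meixnerSum β ξ q :=
  tsum_congr fun x => by rw [h]

theorem meixnerSum_add (hβ : 0 < β) (hξ : 0 < ξ) (hξ1 : ξ < 1) (p q : ℝ[X]) :
    meixnerSum β ξ (p + q) = meixnerSum β ξ p + meixnerSum β ξ q := by
  simp only [meixnerSum, eval_add, mul_add]
  exact (summable_meixnerWeight_mul_eval hβ hξ hξ1 p).tsum_add
    (summable_meixnerWeight_mul_eval hβ hξ hξ1 q)

theorem meixnerSum_C_mul (a : ℝ) (p : ℝ[X]) :
    meixnerSum β ξ (C a * p) = a * meixnerSum β ξ p := by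
  simp only [meixnerSum, eval_mul, eval_C, ← tsum_mul_left]
  exact tsum_congr fun x => by ring

theorem meixnerSum_one_pos (hβ : 0 < β) (hξ : 0 < ξ) (hξ1 : ξ < 1) : 0 < meixnerSum β ξ 1 :=
  (summable_meixnerWeight_mul_eval hβ hξ hξ1 1).tsum_pos
    (fun x => by simpa using (meixnerWeight_pos hβ hξ x).le) 0
    (by simpa using meixnerWeight_pos hβ hξ 0)

/-- Summation by parts against the Meixner weight. -/
theorem tsum_meixnerWeight_mul_nat {E : Type*} [NormedAddCommGroup E] [NormedSpace ℝ E]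
    (f : ℕ → E) (hf : Summable fun x : ℕ => (meixnerWeight β ξ x * x) • f x) :
    ∑' x : ℕ, (meixnerWeight β ξ x * x) • f x =
      ∑' x : ℕ, (meixnerWeight β ξ x * (ξ * (x + β))) • f (x + 1) := by
  rw [hf.tsum_eq_zero_add]
  -- The boundary term at x = 0 vanishes because of the factor x.
  simp only [Nat.cast_zero, mul_zero, zero_smul, zero_add]
  refine tsum_congr fun x => ?_
  push_cast
  rw [meixnerWeight_succ, mul_comm]

theorem meixnerSum_X_mul (hβ : 0 < β) (hξ : 0 < ξ) (hξ1 : ξ < 1) (p : ℝ[X]) :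
    meixnerSum β ξ (X * p) = meixnerSum β ξ (C ξ * (X + C β) * p.comp (X + 1)) := by
  have h0 := summable_meixnerWeight_mul_eval hβ hξ hξ1 (X * p)
  simp only [eval_mul, eval_X, ← mul_assoc] at h0
  have h := tsum_meixnerWeight_mul_nat (fun x : ℕ => p.eval (x : ℝ)) h0
  simpa [meixnerSum, mul_assoc] using h

/-- The Meixner difference operator. -/
noncomputable def meixnerOp (β ξ : ℝ) (p : ℝ[X]) : ℝ[X] :=
  C ξ * (X + C β) * (p.comp (X + 1) - p) - X * (p - p.comp (X - 1))

/-- Summation by parts puts the operator in Dirichlet form, symmetric in p and q; this is the source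
of self-adjointness. -/
theorem meixnerSum_meixnerOp_mul (hβ : 0 < β) (hξ : 0 < ξ) (hξ1 : ξ < 1) (p q : ℝ[X]) :
    meixnerSum β ξ (meixnerOp β ξ p * q) =
      -meixnerSum β ξ (C ξ * (X + C β) * ((p.comp (X + 1) - p) * (q.comp (X + 1) - q))) := by
  have h := meixnerSum_X_mul hβ hξ hξ1 ((p - p.comp (X - 1)) * q)
  have e : meixnerOp β ξ p * q + X * ((p - p.comp (X - 1)) * q) +
      C ξ * (X + C β) * ((p.comp (X + 1) - p) * (q.comp (X + 1) - q)) =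
      C ξ * (X + C β) * ((p - p.comp (X - 1)) * q).comp (X + 1) := by
    have : (p.comp (X - 1)).comp (X + 1) = p := by simp [comp_assoc]
    simp only [mul_comp, sub_comp, this, meixnerOp]
    ring
  have h2 := congrArg (meixnerSum β ξ) e
  rw [meixnerSum_add hβ hξ hξ1, meixnerSum_add hβ hξ hξ1, ← h] at h2
  linarith

theorem meixnerSum_meixnerOp_comm (hβ : 0 < β) (hξ : 0 < ξ) (hξ1 : ξ < 1) (p q : ℝ[X]) :
    meixnerSum β ξ (meixnerOp β ξ p * q) = meixnerSum β ξ (meixnerOp β ξ q * p) := by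
  rw [meixnerSum_meixnerOp_mul hβ hξ hξ1, meixnerSum_meixnerOp_mul hβ hξ hξ1,
    mul_comm (p.comp (X + 1) - p)]

/-! ### Meixner polynomials -/

/-- The coefficients of the Meixner polynomial of degree `n` in the basis of binomial
coefficients. -/
noncomputable def meixnerCoeff (β ξ : ℝ) (n k : ℕ) : ℝ :=
  n.choose k * (k ! / (ascPochhammer ℝ k).eval β * (1 - ξ⁻¹) ^ k)

/-- The values of the Meixner polynomials at nonnegative integers. -/
noncomputable def meixnerVal (β ξ : ℝ) (n x : ℕ) : ℝ :=
  ∑ k ∈ Finset.range (n + 1), meixnerCoeff β ξ n k * x.choose k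

theorem meixnerVal_eq_sum {n m : ℕ} (h : n < m) (x : ℕ) :
    meixnerVal β ξ n x = ∑ k ∈ Finset.range m, meixnerCoeff β ξ n k * x.choose k := by
  refine Finset.sum_subset (Finset.range_mono h) fun k _ hk => ?_
  have : n < k := by simpa using hk
  simp [meixnerCoeff, Nat.choose_eq_zero_of_lt this]

/-- Self-duality, the pivot of the whole argument: each summand is symmetric in n and x, since both
enter only through binomial coefficients. -/
theorem meixnerVal_comm (n x : ℕ) : meixnerVal β ξ n x = meixnerVal β ξ x n := by
  rw [meixnerVal_eq_sum (m := n + x + 1) (by omega), meixnerVal_eq_sum (m := n + x + 1) (by omega)]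
  exact Finset.sum_congr rfl fun k _ => by simp only [meixnerCoeff]; ring

theorem meixnerVal_zero_left (x : ℕ) : meixnerVal β ξ 0 x = 1 := by
  simp [meixnerVal, meixnerCoeff]

theorem natCast_mul_choose (x k : ℕ) :
    (x : ℝ) * x.choose k = k * x.choose k + (k + 1) * x.choose (k + 1) := by
  have h := Nat.choose_succ_right_eq x k
  by_cases hk : k ≤ x
  · have : ((x.choose (k + 1) * (k + 1) : ℕ) : ℝ) = (x.choose k * (x - k) : ℕ) := by rw [h]
    push_cast [Nat.cast_sub hk] at this
    linarith
  · rw [Nat.choose_eq_zero_of_lt (by omega), Nat.choose_eq_zero_of_lt (by omega)]; simp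

theorem natCast_mul_choose_pred (x k : ℕ) :
    (x : ℝ) * (x - 1).choose k = (x - k) * x.choose k := by
  rcases x with _ | x
  · rcases k with _ | k <;> simp
  · have h1 := natCast_mul_choose (x + 1) k
    have h2 : (((x + 1) * x.choose k : ℕ) : ℝ) = ((x + 1).choose (k + 1) * (k + 1) : ℕ) := by
      rw [← Nat.add_one_mul_choose_eq]
    push_cast at h1 h2 ⊢
    linarith

theorem meixnerCoeff_succ (hβ : 0 < β) (hξ : 0 < ξ) (n k : ℕ) :
    meixnerCoeff β ξ n (k + 1) * (ξ * (β + k)) = -(1 - ξ) * (n - k) * meixnerCoeff β ξ n k := by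
  have h1 := natCast_mul_choose n k
  have h2 : ((n : ℝ) - k) * n.choose k = (k + 1) * n.choose (k + 1) := by linarith
  have h3 := (ascPochhammer_pos k β hβ).ne'
  have h4 : β + k ≠ 0 := by positivity
  simp only [meixnerCoeff, ascPochhammer_succ_eval, Nat.factorial_succ, Nat.cast_mul,
    Nat.cast_succ]
  have h5 : (1 - ξ⁻¹) ^ (k + 1) * ξ = -(1 - ξ) * (1 - ξ⁻¹) ^ k := by
    rw [pow_succ]; field_simp; ring
  calc _ = (k + 1) * n.choose (k + 1) * (k ! / (ascPochhammer ℝ k).eval β) *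
        ((1 - ξ⁻¹) ^ (k + 1) * ξ) := by field_simp
    _ = _ := by rw [h5, ← h2]; ring

/-- In the binomial basis the difference operator is bidiagonal: C(x,k) goes to -(1-ξ)k C(x,k) +
ξ(β+k-1) C(x,k-1). The coefficient recursion `meixnerCoeff_succ` makes the sum an eigenfunction. -/
theorem meixnerVal_difference (hβ : 0 < β) (hξ : 0 < ξ) (n x : ℕ) :
    ξ * (x + β) * meixnerVal β ξ n (x + 1) + x * meixnerVal β ξ n (x - 1) -
      (x + ξ * (x + β)) * meixnerVal β ξ n x = -(1 - ξ) * n * meixnerVal β ξ n x := by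
  set a := meixnerCoeff β ξ n
  -- `g k` is the lowered contribution on C(x,k-1). Reindexing by one loses nothing, because the
  -- factor n - k kills the top term k = n.
  set g : ℕ → ℝ := fun k => if k = 0 then 0 else
    -(1 - ξ) * (n - (k - 1 : ℕ)) * a (k - 1) * x.choose (k - 1)
  have hterm : ∀ k, a k * (ξ * (x + β) * (x + 1).choose k + x * (x - 1).choose k -
      (x + ξ * (x + β)) * x.choose k) = g k - (1 - ξ) * k * a k * x.choose k := by
    intro k
    rw [natCast_mul_choose_pred]
    rcases k with _ | k
    · simp [g]; right; ring
    · have h1 := natCast_mul_choose x k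
      have h2 : a (k + 1) * (ξ * (β + k)) = -(1 - ξ) * (n - k) * a k := meixnerCoeff_succ hβ hξ n k
      have h3 : g (k + 1) = -(1 - ξ) * (n - k) * a k * x.choose k := by simp [g]
      rw [h3, ← h2, Nat.choose_succ_succ' x k]
      push_cast
      linear_combination (a (k + 1) * ξ) * h1
  have hg : ∑ k ∈ Finset.range (n + 1), g k =
      ∑ k ∈ Finset.range (n + 1), -(1 - ξ) * (n - k) * a k * x.choose k := by
    rw [Finset.sum_range_succ', Finset.sum_range_succ]
    simp [g]
  have := Finset.sum_congr (s₁ := Finset.range (n + 1)) rfl fun k _ => hterm k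
  rw [Finset.sum_sub_distrib, hg, ← Finset.sum_sub_distrib] at this
  simp only [meixnerVal, Finset.mul_sum]
  rw [← Finset.sum_add_distrib, ← Finset.sum_sub_distrib]
  refine Eq.trans (Finset.sum_congr rfl fun k _ => ?_)
    (this.trans (Finset.sum_congr rfl fun k _ => ?_)) <;> ring

/-- The three-term recurrence relation of the Meixner polynomials. -/
theorem meixnerVal_recurrence (hβ : 0 < β) (hξ : 0 < ξ) (n x : ℕ) :
    ξ * (n + β) * meixnerVal β ξ (n + 1) x + n * meixnerVal β ξ (n - 1) x -
      (n + ξ * (n + β)) * meixnerVal β ξ n x = -(1 - ξ) * x * meixnerVal β ξ n x := by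
  -- By duality the recurrence in the degree is the difference equation in the variable.
  simp only [meixnerVal_comm _ x]
  exact meixnerVal_difference hβ hξ x n

/-- The Meixner polynomials. -/
noncomputable def meixnerPoly (β ξ : ℝ) (n : ℕ) : ℝ[X] :=
  ∑ k ∈ Finset.range (n + 1), C (meixnerCoeff β ξ n k / k !) * descPochhammer ℝ k

theorem eval_meixnerPoly (n x : ℕ) : (meixnerPoly β ξ n).eval (x : ℝ) = meixnerVal β ξ n x := by
  simp only [meixnerPoly, meixnerVal, eval_finsetSum, eval_mul, eval_C,
    descPochhammer_eval_eq_descFactorial, Nat.descFactorial_eq_factorial_mul_choose, Nat.cast_mul]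
  refine Finset.sum_congr rfl fun k _ => ?_
  have : (k ! : ℝ) ≠ 0 := by positivity
  field_simp

theorem meixnerPoly_mem_degreeLT {n N : ℕ} (h : n < N) : meixnerPoly β ξ n ∈ degreeLT ℝ N := by
  refine Submodule.sum_mem _ fun k hk => ?_
  rw [mem_degreeLT]
  refine degree_le_natDegree.trans_lt ?_
  refine (WithBot.coe_le_coe.2 (natDegree_C_mul_le _ _)).trans_lt ?_
  rw [descPochhammer_natDegree]
  have : k < n + 1 := by simpa using hk
  exact WithBot.coe_lt_coe.2 (show k < N by omega)

/-- Eigenfunctions of a symmetric operator with distinct eigenvalues -(1-ξ)m and -(1-ξ)n. -/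
theorem meixnerSum_mul_of_ne (hβ : 0 < β) (hξ : 0 < ξ) (hξ1 : ξ < 1) {m n : ℕ} (h : m ≠ n) :
    meixnerSum β ξ (meixnerPoly β ξ m * meixnerPoly β ξ n) = 0 := by
  have hop : ∀ m (q : ℝ[X]), meixnerSum β ξ (meixnerOp β ξ (meixnerPoly β ξ m) * q) =
      -(1 - ξ) * m * meixnerSum β ξ (meixnerPoly β ξ m * q) := by
    intro m q
    rw [← meixnerSum_C_mul]
    refine meixnerSum_congr fun x => ?_
    have h1 := meixnerVal_difference hβ hξ m x
    have h2 : (x : ℝ) * (meixnerPoly β ξ m).eval ((x : ℝ) - 1) = x * meixnerVal β ξ m (x - 1) := by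
      rcases x with _ | x
      · simp
      · rw [← eval_meixnerPoly]; simp
    have h3 : (meixnerPoly β ξ m).eval ((x : ℝ) + 1) = meixnerVal β ξ m (x + 1) := by
      rw [← eval_meixnerPoly]; simp
    simp only [meixnerOp, eval_mul, eval_sub, eval_add, eval_C, eval_X, eval_comp, eval_one,
      eval_meixnerPoly, h3]
    linear_combination (q.eval (x : ℝ)) * (h1 + h2)
  have h1 := meixnerSum_meixnerOp_comm hβ hξ hξ1 (meixnerPoly β ξ m) (meixnerPoly β ξ n)
  rw [hop, hop, mul_comm (meixnerPoly β ξ n)] at h1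
  have h2 : ((1 - ξ) * (m - n)) * meixnerSum β ξ (meixnerPoly β ξ m * meixnerPoly β ξ n) = 0 := by
    linarith
  have h3 : (1 - ξ) * ((m : ℝ) - n) ≠ 0 :=
    mul_ne_zero (by linarith) (sub_ne_zero.2 (by exact_mod_cast h))
  exact (mul_eq_zero.1 h2).resolve_left h3

/-- Evaluating the pairing of x M_n with M_{n+1} by the recurrence at n and at n+1 gives
ξ(n+β)h_{n+1} = (n+1)h_n for the squared norms h_n. This is inverse to the recursion of the weight,
so W(n)h_n is constant. -/
theorem meixnerWeight_mul_meixnerSum_sq (hβ : 0 < β) (hξ : 0 < ξ) (hξ1 : ξ < 1) (n : ℕ) :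
    meixnerWeight β ξ n * meixnerSum β ξ (meixnerPoly β ξ n * meixnerPoly β ξ n) =
      meixnerSum β ξ 1 := by
  have hrec : ∀ n (q : ℝ[X]), -(1 - ξ) * meixnerSum β ξ (X * meixnerPoly β ξ n * q) =
      ξ * (n + β) * meixnerSum β ξ (meixnerPoly β ξ (n + 1) * q) +
      (n * meixnerSum β ξ (meixnerPoly β ξ (n - 1) * q) +
      -(n + ξ * (n + β)) * meixnerSum β ξ (meixnerPoly β ξ n * q)) := by
    intro n q
    simp only [← meixnerSum_C_mul, ← meixnerSum_add hβ hξ hξ1]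
    refine meixnerSum_congr fun x => ?_
    simp only [eval_mul, eval_add, eval_C, eval_X, eval_meixnerPoly]
    linear_combination -(q.eval (x : ℝ)) * meixnerVal_recurrence hβ hξ n x
  induction n with
  | zero =>
    have : meixnerWeight β ξ 0 = 1 := by simp [meixnerWeight]
    rw [this, one_mul]
    exact meixnerSum_congr fun x => by simp [eval_meixnerPoly, meixnerVal_zero_left]
  | succ n ih =>
    have h1 := hrec n (meixnerPoly β ξ (n + 1))
    have h2 := hrec (n + 1) (meixnerPoly β ξ n)
    have hne : ∀ {a b}, a ≠ b → meixnerSum β ξ (meixnerPoly β ξ a * meixnerPoly β ξ b) = 0 :=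
      fun h => meixnerSum_mul_of_ne hβ hξ hξ1 h
    rw [hne (by omega : n - 1 ≠ n + 1), hne (by omega : n ≠ n + 1)] at h1
    rw [hne (by omega : n + 1 + 1 ≠ n), hne (by omega : n + 1 ≠ n), Nat.add_sub_cancel] at h2
    have h3 : X * meixnerPoly β ξ n * meixnerPoly β ξ (n + 1) =
        X * meixnerPoly β ξ (n + 1) * meixnerPoly β ξ n := by ring
    rw [h3, h2] at h1
    push_cast at h1
    have h4 := meixnerWeight_succ β ξ n
    have h5 : (n : ℝ) + 1 ≠ 0 := by positivity
    rw [← ih]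
    apply mul_left_cancel₀ h5
    linear_combination (meixnerSum β ξ (meixnerPoly β ξ (n + 1) * meixnerPoly β ξ (n + 1))) * h4
      - meixnerWeight β ξ n * h1

/-! ### The Meixner kernel -/

/-- The orthonormal Meixner functions, as functions on nonnegative integers. -/
noncomputable def meixnerFun (β ξ : ℝ) (n x : ℕ) : ℝ :=
  √(meixnerWeight β ξ x) * (√(meixnerWeight β ξ n / meixnerSum β ξ 1) * meixnerVal β ξ n x)

theorem hasSum_meixnerFun_mul (hβ : 0 < β) (hξ : 0 < ξ) (hξ1 : ξ < 1) (m n : ℕ) :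
    HasSum (fun x => meixnerFun β ξ m x * meixnerFun β ξ n x) (if m = n then 1 else 0) := by
  have hS := meixnerSum_one_pos hβ hξ hξ1
  have h := (summable_meixnerWeight_mul_eval hβ hξ hξ1
    (meixnerPoly β ξ m * meixnerPoly β ξ n)).hasSum.mul_left
    (√(meixnerWeight β ξ m / meixnerSum β ξ 1) * √(meixnerWeight β ξ n / meixnerSum β ξ 1))
  convert! h using 1
  · funext x
    have := Real.mul_self_sqrt (meixnerWeight_pos hβ hξ x).le
    simp only [meixnerFun, eval_mul, eval_meixnerPoly]
    linear_combination (√(meixnerWeight β ξ m / meixnerSum β ξ 1) *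
      √(meixnerWeight β ξ n / meixnerSum β ξ 1) * meixnerVal β ξ m x * meixnerVal β ξ n x) * this
  · change _ = _ * meixnerSum β ξ _
    split_ifs with hmn
    · subst hmn
      rw [Real.mul_self_sqrt (div_nonneg (meixnerWeight_pos hβ hξ m).le hS.le), div_mul_eq_mul_div,
        meixnerWeight_mul_meixnerSum_sq hβ hξ hξ1, div_self hS.ne']
    · rw [meixnerSum_mul_of_ne hβ hξ hξ1 hmn, mul_zero]

/-- The N orthonormal Meixner functions lie in a space of dimension at most N, hence form a basis of
it. -/
theorem meixnerKernel_eq_sum (hβ : 0 < β) (hξ : 0 < ξ) (hξ1 : ξ < 1) (N x y : ℕ) :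
    meixnerKernel N β ξ x y = ∑ n ∈ Finset.range N, meixnerFun β ξ n x * meixnerFun β ξ n y := by
  have hmem : ∀ n, Memℓp (fun x => meixnerFun β ξ n x) 2 := fun n => by
    refine memℓp_gen ?_
    simpa [sq] using (hasSum_meixnerFun_mul hβ hξ hξ1 n n).summable
  set ψ : ℕ → EllTwo := fun n => ⟨fun x => meixnerFun β ξ n x, hmem n⟩
  have hψ : ∀ n x, ψ n x = meixnerFun β ξ n x := fun n x => rfl
  have hin : ∀ m n, inner ℝ (ψ m) (ψ n) = if m = n then 1 else 0 := fun m n => by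
    refine HasSum.unique (lp.hasSum_inner (𝕜 := ℝ) (ψ m) (ψ n)) ?_
    simpa [hψ, mul_comm] using hasSum_meixnerFun_mul hβ hξ hξ1 m n
  set U := polySubspace (meixnerWeight β ξ) N
  have hU : ∀ n : Fin N, ψ n ∈ U := fun n => by
    refine ⟨⟨√(meixnerWeight β ξ n / meixnerSum β ξ 1) • meixnerPoly β ξ n,
      Submodule.smul_mem _ _ (meixnerPoly_mem_degreeLT n.2)⟩, ?_⟩
    funext x
    change √(meixnerWeight β ξ x) * eval (x : ℝ) (√(meixnerWeight β ξ n / meixnerSum β ξ 1) •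
      meixnerPoly β ξ n) = meixnerFun β ξ n x
    rw [eval_smul, eval_meixnerPoly, smul_eq_mul, meixnerFun]
  set e : Fin N → U := fun n => ⟨ψ n, hU n⟩
  have he : Orthonormal ℝ e := by
    rw [orthonormal_iff_ite]
    intro i j
    simpa [e, Fin.ext_iff] using hin i j
  have hdim : Module.finrank ℝ U ≤ N := by
    have h1 : Module.finrank ℝ U ≤
        Module.finrank ℝ (LinearMap.range (weightedPoly (meixnerWeight β ξ) N)) := by
      have : FiniteDimensional ℝ (degreeLT ℝ N) := (degreeLTEquiv ℝ N).symm.finiteDimensional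
      let g : U →ₗ[ℝ] LinearMap.range (weightedPoly (meixnerWeight β ξ) N) :=
        ellTwoIncl.restrict (fun _ hx => hx)
      refine LinearMap.finrank_le_finrank_of_injective (f := g) fun a b h => ?_
      have h' : (g a : ℕ → ℝ) = g b := by rw [h]
      exact Subtype.ext (lp.ext h')
    have : FiniteDimensional ℝ (degreeLT ℝ N) := (degreeLTEquiv ℝ N).symm.finiteDimensional
    refine h1.trans ((LinearMap.finrank_range_le _).trans ?_)
    rw [(degreeLTEquiv ℝ N).finrank_eq]; simp
  have hspan : ⊤ ≤ Submodule.span ℝ (Set.range e) := by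
    have h1 := finrank_span_eq_card he.linearIndependent
    refine (Submodule.eq_top_of_finrank_eq (le_antisymm (Submodule.finrank_le _) ?_)).ge
    rw [h1]; simpa using hdim
  set b := OrthonormalBasis.mk he hspan
  have hb : ∀ i, ((b i : U) : EllTwo) = ψ i := fun i => by simp [b, e]
  have hP : U.starProjection (lp.single 2 y (1 : ℝ)) =
      ∑ i : Fin N, meixnerFun β ξ i y • ψ i := by
    rw [b.starProjection_eq_sum_rankOne]
    simp only [_root_.sum_apply, InnerProductSpace.rankOne_apply, hb]
    refine Finset.sum_congr rfl fun i _ => ?_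
    congr 1
    rw [lp.inner_single_right]
    simp [hψ]
  change (U.starProjection (lp.single 2 y (1 : ℝ)) : EllTwo) x = _
  rw [hP, lp.coeFn_sum, Finset.sum_apply, ← Fin.sum_univ_eq_sum_range
    (fun n => meixnerFun β ξ n x * meixnerFun β ξ n y)]
  exact Finset.sum_congr rfl fun i _ => by simp [hψ, mul_comm]

end Meixner

/-! ### The standardized negative binomial law -/

section MeixnerLaw

variable {β ξ : ℝ}

/-- The standardization of a negative binomial variable. -/
noncomputable def meixnerStd (β ξ : ℝ) (n : ℕ) : ℝ :=
  ((1 - ξ) * n - ξ * β) / √(ξ * β)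

/-- The law of the standardized negative binomial variable. -/
noncomputable def meixnerLaw (β ξ : ℝ) : Measure ℝ :=
  Measure.sum fun n : ℕ => ENNReal.ofReal (meixnerWeight β ξ n / meixnerSum β ξ 1) •
    Measure.dirac (meixnerStd β ξ n)

theorem meixnerWeight_div_nonneg (hβ : 0 < β) (hξ : 0 < ξ) (hξ1 : ξ < 1) (n : ℕ) :
    0 ≤ meixnerWeight β ξ n / meixnerSum β ξ 1 :=
  div_nonneg (meixnerWeight_pos hβ hξ n).le (meixnerSum_one_pos hβ hξ hξ1).le

theorem isProbabilityMeasure_meixnerLaw (hβ : 0 < β) (hξ : 0 < ξ) (hξ1 : ξ < 1) :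
    IsProbabilityMeasure (meixnerLaw β ξ) := by
  refine HasSum.isProbabilityMeasure_sum_dirac (meixnerWeight_div_nonneg hβ hξ hξ1) ?_
  have h := (summable_meixnerWeight_mul_eval hβ hξ hξ1 1).hasSum.div_const (meixnerSum β ξ 1)
  have h1 : meixnerSum β ξ 1 / meixnerSum β ξ 1 = 1 :=
    div_self (meixnerSum_one_pos hβ hξ hξ1).ne'
  change HasSum _ (meixnerSum β ξ 1 / meixnerSum β ξ 1) at h
  rw [h1] at h
  simpa using h

theorem integrable_meixnerLaw_iff {E : Type*} [NormedAddCommGroup E] (hβ : 0 < β) (hξ : 0 < ξ)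
    (hξ1 : ξ < 1) {f : ℝ → E} : Integrable f (meixnerLaw β ξ) ↔
      Summable fun n => meixnerWeight β ξ n / meixnerSum β ξ 1 * ‖f (meixnerStd β ξ n)‖ := by
  rw [meixnerLaw, integrable_sum_dirac_iff (by simp)]
  congrm Summable (fun n => ?_ * _)
  rw [ENNReal.toReal_ofReal (meixnerWeight_div_nonneg hβ hξ hξ1 n)]

theorem integral_meixnerLaw {E : Type*} [NormedAddCommGroup E] [NormedSpace ℝ E]
    [FiniteDimensional ℝ E] (hβ : 0 < β) (hξ : 0 < ξ) (hξ1 : ξ < 1) (f : ℝ → E) :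
    ∫ z, f z ∂meixnerLaw β ξ =
      ∑' n, (meixnerWeight β ξ n / meixnerSum β ξ 1) • f (meixnerStd β ξ n) := by
  rw [meixnerLaw, integral_sum_dirac (by simp)]
  congr with n
  rw [ENNReal.toReal_ofReal (meixnerWeight_div_nonneg hβ hξ hξ1 n)]

theorem integrable_eval_meixnerLaw (hβ : 0 < β) (hξ : 0 < ξ) (hξ1 : ξ < 1) (p : ℝ[X]) :
    Integrable (fun z => p.eval z) (meixnerLaw β ξ) := by
  rw [integrable_meixnerLaw_iff hβ hξ hξ1]
  have h := ((summable_meixnerWeight_mul_eval hβ hξ hξ1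
    (p.comp (C (√(ξ * β))⁻¹ * (C (1 - ξ) * X - C (ξ * β))))).norm.div_const (meixnerSum β ξ 1))
  refine h.congr fun n => ?_
  have h2 : (√(ξ * β))⁻¹ * ((1 - ξ) * n - ξ * β) = meixnerStd β ξ n := by
    rw [meixnerStd, div_eq_inv_mul]
  simp only [eval_comp, eval_mul, eval_sub, eval_C, eval_X, h2, norm_mul,
    Real.norm_of_nonneg (meixnerWeight_pos hβ hξ n).le]
  ring

theorem integrable_pow_meixnerLaw (hβ : 0 < β) (hξ : 0 < ξ) (hξ1 : ξ < 1) (k : ℕ) :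
    Integrable (fun z => z ^ k) (meixnerLaw β ξ) := by
  simpa using integrable_eval_meixnerLaw hβ hξ hξ1 (X ^ k)

/-- Stein's identity for the standardized negative binomial law. -/
theorem integral_meixnerLaw_stein {E : Type*} [NormedAddCommGroup E] [NormedSpace ℝ E]
    [FiniteDimensional ℝ E] (hβ : 0 < β) (hξ : 0 < ξ) (hξ1 : ξ < 1) (f : ℝ → E)
    (hf : Integrable (fun z => (z + √(ξ * β)) • f z) (meixnerLaw β ξ)) :
    ∫ z, (z + √(ξ * β)) • f z ∂meixnerLaw β ξ =
      ∫ z, (ξ * z + √(ξ * β)) • f (z + (1 - ξ) / √(ξ * β)) ∂meixnerLaw β ξ := by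
  set s := √(ξ * β)
  have hs : 0 < s := Real.sqrt_pos.2 (mul_pos hξ hβ)
  have hs2 : s ^ 2 = ξ * β := Real.sq_sqrt (mul_pos hξ hβ).le
  have h1ξ : 1 - ξ ≠ 0 := by linarith
  -- With s = √(ξβ), z + s is a multiple of n, and ξz + s is the same multiple of ξ(n+β); Stein's
  -- identity is therefore summation by parts in standardized form.
  have hz : ∀ n : ℕ, meixnerStd β ξ n + s = (1 - ξ) / s * n := fun n => by
    change ((1 - ξ) * n - ξ * β) / s + s = _
    rw [← hs2]; field_simp; ring
  rw [integral_meixnerLaw hβ hξ hξ1, integral_meixnerLaw hβ hξ hξ1]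
  rw [integrable_meixnerLaw_iff hβ hξ hξ1] at hf
  set S := meixnerSum β ξ 1
  have hS : 0 < S := meixnerSum_one_pos hβ hξ hξ1
  have hsum : Summable fun n : ℕ => (meixnerWeight β ξ n * n) • f (meixnerStd β ξ n) := by
    refine Summable.of_norm ((hf.mul_left (S * s / (1 - ξ))).congr fun n => ?_)
    rw [hz, norm_smul, norm_smul, Real.norm_of_nonneg (mul_nonneg
      (meixnerWeight_pos hβ hξ n).le n.cast_nonneg), Real.norm_of_nonneg (mul_nonneg
      (div_nonneg (by linarith) hs.le) n.cast_nonneg)]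
    field_simp
  have key := congrArg (fun e => ((1 - ξ) / (S * s)) • e) (tsum_meixnerWeight_mul_nat _ hsum)
  simp only [← tsum_const_smul'', smul_smul] at key
  refine Eq.trans (tsum_congr fun n => ?_) (key.trans (tsum_congr fun n => ?_))
  · rw [hz, smul_smul]
    congr 1
    field_simp
  · have h1 : meixnerStd β ξ (n + 1) = meixnerStd β ξ n + (1 - ξ) / s := by
      simp only [meixnerStd]; push_cast; ring
    have h2 : ξ * meixnerStd β ξ n + s = (1 - ξ) / s * (ξ * (n + β)) := by
      have := hz n
      have h3 : ξ * meixnerStd β ξ n = ξ * ((1 - ξ) / s * n - s) := by rw [← this]; ring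
      rw [h3]
      field_simp
      linear_combination (1 - ξ) * hs2
    rw [smul_smul, h1, h2]
    congr 1
    field_simp

/-- The moments of the standardized negative binomial laws are uniformly bounded. -/
theorem exists_bound_moment_meixnerLaw (k : ℕ) : ∃ B : ℝ, ∀ β ξ : ℝ, 0 < β → 0 < ξ → ξ < 1 →
    1 ≤ √(ξ * β) → |∫ z, z ^ k ∂meixnerLaw β ξ| ≤ B := by
  induction k using Nat.strong_induction_on with
  | _ k ih =>
  rcases k with _ | k
  · refine ⟨1, fun β ξ hβ hξ hξ1 _ => ?_⟩
    have := isProbabilityMeasure_meixnerLaw hβ hξ hξ1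
    simp
  choose B hB using ih
  -- Total extension of the inductive bounds; the default 0 is never used.
  set B' : ℕ → ℝ := fun j => if h : j < k + 1 then B j h else 0
  have hB' : ∀ j < k + 1, ∀ β ξ : ℝ, 0 < β → 0 < ξ → ξ < 1 →
    1 ≤ √(ξ * β) → |∫ z, z ^ j ∂meixnerLaw β ξ| ≤ B' j := by
    intro j hj
    simp only [B', dif_pos hj]
    exact hB j hj
  refine ⟨∑ j ∈ Finset.range k, k.choose j * (B' (j + 1) + B' j), fun β ξ hβ hξ hξ1 hs => ?_⟩
  have hint := integrable_pow_meixnerLaw hβ hξ hξ1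
  set m : ℕ → ℝ := fun j => ∫ z, z ^ j ∂meixnerLaw β ξ
  have hst := integral_meixnerLaw_stein hβ hξ hξ1 (fun z : ℝ => z ^ k) (by
    simpa [add_mul, ← pow_succ'] using (hint (k + 1)).fun_add ((hint k).const_mul (√(ξ * β))))
  set s := √(ξ * β)
  have hs0 : 0 < s := by linarith
  set δ := (1 - ξ) / s
  have hδ : δ * s = 1 - ξ := by simp only [δ]; field_simp
  have hδ0 : 0 ≤ δ := div_nonneg (by linarith) hs0.le
  have hδ1 : δ ≤ 1 := by rw [div_le_one hs0]; linarith
  have hL : ∫ z, (z + s) • z ^ k ∂meixnerLaw β ξ = m (k + 1) + s * m k := by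
    simp only [smul_eq_mul, add_mul, ← pow_succ']
    rw [integral_add (hint _) ((hint _).const_mul _), integral_const_mul]
  have hR : ∫ z, (ξ * z + s) • (z + δ) ^ k ∂meixnerLaw β ξ =
      ∑ j ∈ Finset.range (k + 1), k.choose j * δ ^ (k - j) * (ξ * m (j + 1) + s * m j) := by
    have : ∀ z : ℝ, (ξ * z + s) • (z + δ) ^ k = ∑ j ∈ Finset.range (k + 1),
        k.choose j * δ ^ (k - j) * (ξ * z ^ (j + 1) + s * z ^ j) := fun z => by
      rw [smul_eq_mul, add_pow, Finset.mul_sum]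
      exact Finset.sum_congr rfl fun j _ => by ring
    simp only [this]
    rw [integral_finsetSum _ fun j _ =>
      (((hint (j + 1)).const_mul ξ).fun_add ((hint j).const_mul s)).const_mul
        (k.choose j * δ ^ (k - j) : ℝ)]
    refine Finset.sum_congr rfl fun j _ => ?_
    rw [integral_const_mul, integral_add ((hint _).const_mul _) ((hint _).const_mul _),
      integral_const_mul, integral_const_mul]
  rw [hL, hR, Finset.sum_range_succ] at hst
  simp only [Nat.choose_self, Nat.sub_self, pow_zero, Nat.cast_one, one_mul] at hst
  -- Each remaining j < k has at least one factor δ, and δs = 1 - ξ, so 1 - ξ cancels and the bound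
  -- is uniform in ξ. The assumption s ≥ 1 gives δ ≤ 1 and ξ/s ≤ 1.
  have h1 : (1 - ξ) * m (k + 1) = (1 - ξ) * ∑ j ∈ Finset.range k,
      k.choose j * δ ^ (k - 1 - j) * (ξ / s * m (j + 1) + m j) := by
    have : (1 - ξ) * m (k + 1) = ∑ j ∈ Finset.range k,
      k.choose j * δ ^ (k - j) * (ξ * m (j + 1) + s * m j) := by linarith
    rw [this, Finset.mul_sum]
    refine Finset.sum_congr rfl fun j hj => ?_
    have hj' : j < k := by simpa using hj
    rw [show k - j = (k - 1 - j) + 1 by omega, pow_succ, ← hδ]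
    field_simp
  have h2 := mul_left_cancel₀ (by linarith : 1 - ξ ≠ 0) h1
  change |m (k + 1)| ≤ _
  rw [h2]
  refine (Finset.abs_sum_le_sum_abs _ _).trans (Finset.sum_le_sum fun j hj => ?_)
  have hj' : j < k := by simpa using hj
  have hb1 := hB' j (by omega) β ξ hβ hξ hξ1 hs
  have hb2 := hB' (j + 1) (by omega) β ξ hβ hξ hξ1 hs
  have h3 : |ξ / s * m (j + 1) + m j| ≤ B' (j + 1) + B' j := by
    refine (abs_add_le _ _).trans (add_le_add ?_ hb1)
    rw [abs_mul, abs_of_nonneg (by positivity : 0 ≤ ξ / s)]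
    have : ξ / s ≤ 1 := by rw [div_le_one hs0]; linarith
    calc _ ≤ 1 * |m (j + 1)| := by gcongr
      _ ≤ _ := by rw [one_mul]; exact hb2
  rw [abs_mul, abs_mul, abs_of_nonneg (by positivity : (0 : ℝ) ≤ k.choose j),
    abs_of_nonneg (by positivity : 0 ≤ δ ^ (k - 1 - j))]
  have h4 : δ ^ (k - 1 - j) ≤ 1 := pow_le_one₀ hδ0 hδ1
  calc _ ≤ (k.choose j : ℝ) * 1 * |ξ / s * m (j + 1) + m j| := by gcongr
    _ ≤ _ := by rw [mul_one]; gcongr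

/-! ### Convergence to the Gaussian law -/

open Complex in
theorem hasDerivAt_charFun_real {μ : Measure ℝ} [IsFiniteMeasure μ]
    (h : Integrable (fun z : ℝ => z) μ) (t : ℝ) :
    HasDerivAt (charFun μ) (I * ∫ z, (z : ℂ) * cexp (t * z * I) ∂μ) t := by
  have h1 : MemLp id ((1 : ℕ) : ℝ≥0∞) μ := by
    rw [Nat.cast_one]; exact memLp_one_iff_integrable.2 h
  have hd : DifferentiableAt ℝ (charFun μ) t :=
    (contDiff_charFun h1).differentiable (by simp) t
  have := hd.hasDerivAt
  rw [← iteratedDeriv_one, iteratedDeriv_charFun h1] at this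
  simpa using this

-- The characteristic function almost satisfies the Gaussian equation φ' = -tφ.
open Complex in
theorem norm_deriv_charFun_meixnerLaw_le (hβ : 0 < β) (hξ : 0 < ξ) (hξ1 : ξ < 1) (t : ℝ)
    (ht : |t| ≤ √(ξ * β)) :
    ‖I * ∫ z, (z : ℂ) * cexp (t * z * I) ∂meixnerLaw β ξ + t * charFun (meixnerLaw β ξ) t‖ ≤
      3 * t ^ 2 / √(ξ * β) := by
  have := isProbabilityMeasure_meixnerLaw hβ hξ hξ1
  have hint : Integrable (fun z : ℝ => z) (meixnerLaw β ξ) := by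
    simpa using integrable_pow_meixnerLaw hβ hξ hξ1 1
  have hexp : ∀ z : ℝ, ‖cexp (t * z * I)‖ = 1 := fun z => by
    rw [← ofReal_mul]; exact norm_exp_ofReal_mul_I _
  have hi0 : Integrable (fun z : ℝ => cexp (t * z * I)) (meixnerLaw β ξ) :=
    (integrable_const (1 : ℝ)).mono' (by fun_prop) (.of_forall fun z => (hexp z).le)
  have hi1 : Integrable (fun z : ℝ => (z : ℂ) * cexp (t * z * I)) (meixnerLaw β ξ) :=
    hint.norm.mono' (by fun_prop) (.of_forall fun z => by simp [hexp])
  have hst := integral_meixnerLaw_stein hβ hξ hξ1 (fun z : ℝ => cexp (t * z * I)) (by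
    simpa [add_mul] using hi1.fun_add (hi0.const_mul (√(ξ * β) : ℂ)))
  set s := √(ξ * β)
  have hs : 0 < s := Real.sqrt_pos.2 (mul_pos hξ hβ)
  set u := t * ((1 - ξ) / s)
  have hu : |u| ≤ 1 := by
    simp only [u]
    rw [abs_mul, abs_of_nonneg (div_nonneg (by linarith) hs.le), mul_div_assoc', div_le_one hs]
    nlinarith [abs_nonneg t]
  rw [charFun_apply_real]
  set D := ∫ z, (z : ℂ) * cexp (t * z * I) ∂meixnerLaw β ξ
  set w := ∫ z, cexp (t * z * I) ∂meixnerLaw β ξ with hw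
  have hw1 : ‖w‖ ≤ 1 := by
    rw [hw, ← charFun_apply_real]; exact norm_charFun_le_one _
  have hL : ∫ z : ℝ, (z + s) • cexp (t * z * I) ∂meixnerLaw β ξ = D + s * w := by
    rw [← integral_const_mul, ← integral_add hi1 (hi0.const_mul _)]
    exact integral_congr_ae (.of_forall fun z => by simp [add_mul])
  have hR : ∫ z : ℝ, (ξ * z + s) • cexp (t * (z + (1 - ξ) / s : ℝ) * I) ∂meixnerLaw β ξ =
      cexp (u * I) * (ξ * D + s * w) := by
    rw [← integral_const_mul, ← integral_const_mul,
      ← integral_add (hi1.const_mul _) (hi0.const_mul _), ← integral_const_mul]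
    refine integral_congr_ae (.of_forall fun z => ?_)
    have : cexp (t * (z + (1 - ξ) / s : ℝ) * I) = cexp (u * I) * cexp (t * z * I) := by
      rw [← Complex.exp_add]; congr 1; simp only [u]; push_cast; ring
    simp only [this, real_smul]
    push_cast
    ring
  rw [hL, hR] at hst
  set e := cexp (u * I)
  have he : ‖e‖ = 1 := norm_exp_ofReal_mul_I _
  -- This lower bound matches the factor 1 - ξ in the error term, so no control of ξ near 1 is
  -- needed.
  have hden : 1 - ξ ≤ ‖1 - ξ * e‖ := by
    have := norm_sub_norm_le (1 : ℂ) (ξ * e)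
    rw [norm_mul, he, norm_one, mul_one, Complex.norm_of_nonneg hξ.le] at this
    exact this
  set ρ := e - 1 - u * I with hρ
  have huI : ‖(u * I : ℂ)‖ = |u| := by simp
  have hρ1 : ‖ρ‖ ≤ u ^ 2 := by
    have := Complex.norm_exp_sub_one_sub_id_le (x := u * I) (by rw [huI]; exact hu)
    rwa [huI, sq_abs] at this
  have he1 : ‖e - 1‖ ≤ 2 * |u| := by
    have := Complex.norm_exp_sub_one_le (x := u * I) (by rw [huI]; exact hu)
    rwa [huI] at this
  have hsu : (s : ℂ) * u = t * (1 - ξ) := by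
    have : s * u = t * (1 - ξ) := by simp only [u]; field_simp
    exact_mod_cast this
  -- Stein's identity for e^{itz} reads (1 - ξe)D = s(e - 1)w with e = e^{iu}. The linear part of e
  -- - 1 contributes -t(1 - ξ)w since su = t(1 - ξ); what remains is of second order.
  have hid : (1 - ξ * e) * (I * D + t * w) = (I * s * ρ - t * ξ * (e - 1)) * w := by
    have h1 : D * (1 - ξ * e) = s * (e - 1) * w := by linear_combination hst
    have h2 : e - 1 = ρ + u * I := by rw [hρ]; ring
    have h3 : I * (s * (u * I)) = -(t * (1 - ξ)) := by
      rw [← hsu]; linear_combination (s * u) * I_sq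
    linear_combination I * h1 + I * s * w * h2 + w * h3
  have hn := congrArg norm hid
  rw [norm_mul, norm_mul] at hn
  have h1 : ‖I * s * ρ - t * ξ * (e - 1)‖ ≤ (1 - ξ) * (3 * t ^ 2 / s) := by
    calc _ ≤ ‖I * s * ρ‖ + ‖t * ξ * (e - 1)‖ := norm_sub_le _ _
      _ = s * ‖ρ‖ + |t| * ξ * ‖e - 1‖ := by
        simp [abs_of_pos hs, abs_of_pos hξ]
      _ ≤ s * u ^ 2 + |t| * 1 * (2 * |u|) := by gcongr
      _ = (1 - ξ) * ((1 - ξ) * t ^ 2 / s + 2 * t ^ 2 / s) := by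
        rw [← sq_abs t]
        simp only [u]
        rw [abs_mul, mul_pow, ← sq_abs t, abs_of_nonneg (div_nonneg (by linarith) hs.le)]
        field_simp
      _ ≤ _ := by
        have : (1 - ξ) * t ^ 2 / s ≤ t ^ 2 / s := by
          gcongr
          nlinarith [sq_nonneg t]
        have h2 : 3 * t ^ 2 / s = t ^ 2 / s + 2 * t ^ 2 / s := by ring
        rw [h2]
        gcongr
  have h2 : (1 - ξ) * ‖I * D + t * w‖ ≤ (1 - ξ) * (3 * t ^ 2 / s) :=
    calc _ ≤ ‖1 - ξ * e‖ * ‖I * D + t * w‖ := by gcongr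
      _ = _ := hn
      _ ≤ (1 - ξ) * (3 * t ^ 2 / s) * 1 := by gcongr
      _ = _ := mul_one _
  exact le_of_mul_le_mul_left h2 (by linarith)

-- The derivative of φ(t)e^{t²/2} is (φ' + tφ)e^{t²/2}, small by the previous estimate; the mean
-- value inequality is applied from t = 0, where the function is 1.
open Complex in
theorem norm_charFun_meixnerLaw_sub_le (hβ : 0 < β) (hξ : 0 < ξ) (hξ1 : ξ < 1) (t : ℝ)
    (ht : |t| ≤ √(ξ * β)) :
    ‖charFun (meixnerLaw β ξ) t * cexp (t ^ 2 / 2) - 1‖ ≤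
      3 * t ^ 2 * Real.exp (t ^ 2 / 2) * |t| / √(ξ * β) := by
  have := isProbabilityMeasure_meixnerLaw hβ hξ hξ1
  have hint : Integrable (fun z : ℝ => z) (meixnerLaw β ξ) := by
    simpa using integrable_pow_meixnerLaw hβ hξ hξ1 1
  have hder : ∀ τ : ℝ, HasDerivAt (fun τ : ℝ => charFun (meixnerLaw β ξ) τ * cexp (τ ^ 2 / 2))
      ((I * ∫ z, (z : ℂ) * cexp (τ * z * I) ∂meixnerLaw β ξ +
        τ * charFun (meixnerLaw β ξ) τ) * cexp (τ ^ 2 / 2)) τ := fun τ => by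
    have h1 : HasDerivAt (fun τ : ℝ => cexp ((τ : ℂ) ^ 2 / 2)) (cexp (τ ^ 2 / 2) * τ) τ := by
      have := ((hasDerivAt_id (τ : ℂ)).pow 2).div_const 2 |>.cexp.comp_ofReal
      convert! this using 1
      simp
    convert! (hasDerivAt_charFun_real hint τ).mul h1 using 1
    ring
  have hb : ∀ τ ∈ Set.uIcc 0 t, ‖(I * ∫ z, (z : ℂ) * cexp (τ * z * I) ∂meixnerLaw β ξ +
        τ * charFun (meixnerLaw β ξ) τ) * cexp (τ ^ 2 / 2)‖ ≤
      3 * t ^ 2 / √(ξ * β) * Real.exp (t ^ 2 / 2) := fun τ hτ => by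
    have h1 : |τ| ≤ |t| := by
      have := Set.abs_sub_left_of_mem_uIcc hτ
      simpa using this
    have h2 : τ ^ 2 ≤ t ^ 2 := sq_le_sq.2 h1
    have h3 : ‖cexp ((τ : ℂ) ^ 2 / 2)‖ = Real.exp (τ ^ 2 / 2) := by
      rw [Complex.norm_exp]; norm_cast
    rw [norm_mul, h3]
    gcongr
    refine (norm_deriv_charFun_meixnerLaw_le hβ hξ hξ1 τ (h1.trans ht)).trans ?_
    gcongr
  have := (convex_uIcc (0 : ℝ) t).norm_image_sub_le_of_norm_hasDerivWithin_le
    (fun τ _ => (hder τ).hasDerivWithinAt) hb Set.left_mem_uIcc Set.right_mem_uIcc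
  simp only [charFun_zero, ofReal_zero, probReal_univ, sub_zero, Real.norm_eq_abs] at this
  refine le_trans (le_of_eq ?_) (this.trans (le_of_eq (by ring)))
  simp

theorem tendsto_charFun_meixnerLaw {β ξ : ℕ → ℝ} (hβ : ∀ i, 0 < β i) (hξ : ∀ i, 0 < ξ i)
    (hξ1 : ∀ i, ξ i < 1) (h : Tendsto (fun i => √(ξ i * β i)) atTop atTop) (t : ℝ) :
    Tendsto (fun i => charFun (meixnerLaw (β i) (ξ i)) t) atTop
      (𝓝 (charFun (ProbabilityTheory.gaussianReal 0 1) t)) := by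
  have h1 : Tendsto (fun i => charFun (meixnerLaw (β i) (ξ i)) t * Complex.exp (t ^ 2 / 2)) atTop
      (𝓝 1) := by
    rw [tendsto_iff_norm_sub_tendsto_zero]
    refine squeeze_zero' (.of_forall fun _ => norm_nonneg _) ?_ (h.const_div_atTop
      (3 * t ^ 2 * Real.exp (t ^ 2 / 2) * |t|))
    filter_upwards [h.eventually_ge_atTop |t|] with i hi
    exact norm_charFun_meixnerLaw_sub_le (hβ i) (hξ i) (hξ1 i) t hi
  have h2 := h1.mul_const (Complex.exp (-(t ^ 2 / 2)))
  rw [ProbabilityTheory.charFun_gaussianReal]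
  convert! h2 using 2
  · rw [mul_assoc, ← Complex.exp_add]; simp
  · simp

end MeixnerLaw

/-! ### Convergence of truncated moments -/

section TruncatedMoments

open ProbabilityTheory

/-- The set where a power truncated at `c` is far from the continuous cutoff of parameters
`R` and `η`. -/
def cutoffSet (c R η : ℝ) : Set ℝ := {z | R ≤ |z|} ∪ {z | |z - c| ≤ η}

theorem isClosed_cutoffSet (c R η : ℝ) : IsClosed (cutoffSet c R η) :=
  (isClosed_le continuous_const continuous_abs).union
    (isClosed_le (by fun_prop) continuous_const)

/-- A bounded continuous approximation of `z ↦ z ^ k` truncated to `z < c`. -/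
noncomputable def cutoffPow (k : ℕ) (c R η z : ℝ) : ℝ :=
  (max (-R) (min R z)) ^ k * max 0 (min 1 ((c - z) / η))

theorem continuous_cutoffPow (k : ℕ) (c R η : ℝ) : Continuous (cutoffPow k c R η) := by
  unfold cutoffPow; fun_prop

theorem abs_clamp_le {R : ℝ} (hR : 0 ≤ R) (z : ℝ) : |max (-R) (min R z)| ≤ R :=
  abs_le.2 ⟨le_max_left _ _, max_le (by linarith) (min_le_left _ _)⟩

theorem abs_clamp_le_abs {R : ℝ} (hR : 0 ≤ R) (z : ℝ) : |max (-R) (min R z)| ≤ |z| := by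
  rcases le_total z R with h | h <;> rcases le_total (-R) z with h' | h'
  · simp [h, h']
  · rw [min_eq_right h, max_eq_left h', abs_neg, abs_of_nonneg hR, abs_of_nonpos (by linarith)]
    linarith
  · rw [min_eq_left h, max_eq_right (by linarith), abs_of_nonneg hR, abs_of_nonneg (by linarith)]
    exact h
  · rw [min_eq_left h, max_eq_right (by linarith), abs_of_nonneg hR, abs_of_nonneg (by linarith)]
    exact h

theorem abs_cutoff_le_one (c η z : ℝ) : |max 0 (min 1 ((c - z) / η))| ≤ 1 := by
  rw [abs_of_nonneg (le_max_left _ _)]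
  exact max_le zero_le_one (min_le_left _ _)

theorem abs_cutoffPow_le {R : ℝ} (hR : 0 ≤ R) (k : ℕ) (c η z : ℝ) :
    |cutoffPow k c R η z| ≤ R ^ k := by
  rw [cutoffPow, abs_mul, abs_pow]
  calc _ ≤ R ^ k * 1 := by
        gcongr
        exacts [abs_clamp_le hR z, abs_cutoff_le_one c η z]
    _ = _ := mul_one _

theorem abs_cutoffPow_le_abs {R : ℝ} (hR : 0 ≤ R) (k : ℕ) (c η z : ℝ) :
    |cutoffPow k c R η z| ≤ |z| ^ k := by
  rw [cutoffPow, abs_mul, abs_pow]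
  calc _ ≤ |z| ^ k * 1 := mul_le_mul (pow_le_pow_left₀ (abs_nonneg _) (abs_clamp_le_abs hR z) k)
        (abs_cutoff_le_one c η z) (abs_nonneg _) (by positivity)
    _ = _ := mul_one _

/-- Off the cutoff set the two functions agree, for every threshold c' within η of c. On it both are
at most |z|^k in absolute value, and 2a ≤ 2εa² + 1/(2ε) trades the difference for a moment and a
measure. -/
theorem abs_indicator_sub_cutoffPow_le {c c' R η ε : ℝ} (hR : 0 ≤ R) (hη : 0 < η) (hε : 0 < ε)
    (hc : |c' - c| ≤ η) (k : ℕ) (z : ℝ) :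
    |(Set.Iio c').indicator (fun z => z ^ k) z - cutoffPow k c R η z| ≤
      2 * ε * z ^ (2 * k) + (2 * ε)⁻¹ * (cutoffSet c R η).indicator 1 z := by
  have hpow : 0 ≤ z ^ (2 * k) := by rw [mul_comm, pow_mul]; positivity
  by_cases hz : z ∈ cutoffSet c R η
  · rw [Set.indicator_of_mem hz, Pi.one_apply, mul_one]
    have h1 : |(Set.Iio c').indicator (fun z => z ^ k) z| ≤ |z| ^ k := by
      by_cases h : z ∈ Set.Iio c'
      · rw [Set.indicator_of_mem h, abs_pow]
      · rw [Set.indicator_of_notMem h, abs_zero]; positivity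
    have h2 := (abs_sub _ _).trans (add_le_add h1 (abs_cutoffPow_le_abs hR k c η z))
    refine h2.trans ?_
    have h3 : z ^ (2 * k) = (|z| ^ k) ^ 2 := by
      rw [mul_comm, pow_mul, ← abs_pow, sq_abs]
    have h4 : (2 * ε) * (2 * ε)⁻¹ = 1 := mul_inv_cancel₀ (by positivity)
    rw [h3]
    set a := |z| ^ k
    have h5 : 0 ≤ (2 * ε) * (a - (2 * ε)⁻¹) ^ 2 := by positivity
    have h6 : (2 * ε) * (a - (2 * ε)⁻¹) ^ 2 =
        2 * ε * a ^ 2 - 2 * a * ((2 * ε) * (2 * ε)⁻¹) + (2 * ε)⁻¹ * ((2 * ε) * (2 * ε)⁻¹) := by ring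
    rw [h6, h4] at h5
    linarith
  · rw [Set.indicator_of_notMem hz, mul_zero, add_zero]
    simp only [cutoffSet, Set.mem_union, Set.mem_ofPred_eq, not_or, not_le] at hz
    obtain ⟨hz1, hz2⟩ := hz
    have hcl : max (-R) (min R z) = z := by
      rw [abs_lt] at hz1
      rw [min_eq_right hz1.2.le, max_eq_right hz1.1.le]
    have hc' := abs_le.1 hc
    have : (Set.Iio c').indicator (fun z => z ^ k) z = cutoffPow k c R η z := by
      rw [cutoffPow, hcl]
      rcases lt_abs.1 hz2 with h | h
      · rw [Set.indicator_of_notMem (by simp; linarith), max_eq_left, mul_zero]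
        exact (min_le_right _ _).trans (div_nonpos_of_nonpos_of_nonneg (by linarith) hη.le)
      · rw [Set.indicator_of_mem (by simp; linarith), min_eq_left, max_eq_right zero_le_one, mul_one]
        rw [le_div_iff₀ hη]; linarith
    rw [this, sub_self, abs_zero]
    positivity

theorem abs_setIntegral_sub_cutoffPow_le {μ : Measure ℝ} [IsProbabilityMeasure μ]
    {c c' R η ε B : ℝ} (hR : 0 ≤ R) (hη : 0 < η) (hε : 0 < ε) (hc : |c' - c| ≤ η) {k : ℕ}
    (hk : Integrable (fun z => z ^ k) μ) (h2k : Integrable (fun z => z ^ (2 * k)) μ)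
    (hB : ∫ z, z ^ (2 * k) ∂μ ≤ B) (hF : μ.real (cutoffSet c R η) ≤ ε ^ 2) :
    |∫ z in Set.Iio c', z ^ k ∂μ - ∫ z, cutoffPow k c R η z ∂μ| ≤ ε * (2 * B + 1) := by
  have hg : Integrable (cutoffPow k c R η) μ :=
    (integrable_const (R ^ k)).mono' (continuous_cutoffPow k c R η).aestronglyMeasurable
      (.of_forall fun z => abs_cutoffPow_le hR k c η z)
  have hFm := (isClosed_cutoffSet c R η).measurableSet
  have hi : Integrable ((cutoffSet c R η).indicator (1 : ℝ → ℝ)) μ :=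
    (integrable_const (1 : ℝ)).indicator hFm
  rw [← integral_indicator measurableSet_Iio, ← integral_sub (hk.indicator measurableSet_Iio) hg]
  refine (abs_integral_le_integral_abs).trans ?_
  refine (integral_mono ((hk.indicator measurableSet_Iio).sub hg).abs
    ((h2k.const_mul (2 * ε)).fun_add (hi.const_mul (2 * ε)⁻¹))
    (fun z => abs_indicator_sub_cutoffPow_le hR hη hε hc k z)).trans ?_
  rw [integral_add (h2k.const_mul _) (hi.const_mul _), integral_const_mul, integral_const_mul,
    integral_indicator_one hFm]
  calc _ ≤ 2 * ε * B + (2 * ε)⁻¹ * ε ^ 2 := by gcongr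
    _ = 2 * ε * B + ε / 2 := by field_simp
    _ ≤ _ := by nlinarith

/-- The cutoff sets with R = m and η = 1/(m+1) decrease to a subset of {c}, which is null. -/
theorem exists_cutoffSet_measure_lt {μ : Measure ℝ} [IsProbabilityMeasure μ] (c : ℝ)
    (hc : μ {c} = 0) {ε : ℝ≥0∞} (hε : 0 < ε) :
    ∃ R η : ℝ, 0 ≤ R ∧ 0 < η ∧ μ (cutoffSet c R η) < ε := by
  have hanti : Antitone fun m : ℕ => cutoffSet c m (1 / (m + 1)) := by
    intro m n hmn z hz
    have h1 : (m : ℝ) ≤ n := by exact_mod_cast hmn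
    have h2 : 1 / ((n : ℝ) + 1) ≤ 1 / (m + 1) := by gcongr
    exact hz.imp (fun h => h1.trans h) (fun h => le_trans h h2)
  have hinter : ⋂ m : ℕ, cutoffSet c m (1 / (m + 1)) ⊆ {c} := by
    intro z hz
    by_contra hzc
    have hpos : 0 < |z - c| := abs_pos.2 (sub_ne_zero.2 hzc)
    obtain ⟨m, hm⟩ := exists_nat_gt (max |z| (1 / |z - c|))
    rcases Set.mem_iInter.1 hz m with h | h
    · exact absurd (le_trans h (le_max_left |z| (1 / |z - c|))) (not_le.2 hm)
    · have h1 : |z - c| ≤ 1 / (m + 1) := h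
      have h2 : 1 / |z - c| < m := (le_max_right _ _).trans_lt hm
      rw [div_lt_iff₀ hpos] at h2
      rw [le_div_iff₀ (by positivity)] at h1
      nlinarith
  have h := tendsto_measure_iInter_atTop (μ := μ)
    (fun m : ℕ => (isClosed_cutoffSet c m (1 / (m + 1))).measurableSet.nullMeasurableSet) hanti
    ⟨0, measure_ne_top _ _⟩
  rw [measure_mono_null hinter hc] at h
  obtain ⟨m, hm⟩ := (h.eventually_lt_const hε).exists
  exact ⟨m, 1 / (m + 1), by positivity, by positivity, hm⟩

/-- Truncated moments converge under weak convergence if the moments of even order are bounded. -/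
theorem tendsto_setIntegral_pow {μ : ℕ → ProbabilityMeasure ℝ} {μ₀ : ProbabilityMeasure ℝ}
    (hμ : Tendsto μ atTop (𝓝 μ₀)) {c : ℕ → ℝ} {c₀ : ℝ} (hc : Tendsto c atTop (𝓝 c₀))
    (hc₀ : (μ₀ : Measure ℝ) {c₀} = 0) (k : ℕ)
    (hint : ∀ i j, Integrable (fun z => z ^ j) (μ i : Measure ℝ))
    (hint₀ : ∀ j, Integrable (fun z => z ^ j) (μ₀ : Measure ℝ)) {B : ℝ}
    (hB : ∀ᶠ i in atTop, ∫ z, z ^ (2 * k) ∂(μ i : Measure ℝ) ≤ B) :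
    Tendsto (fun i => ∫ z in Set.Iio (c i), z ^ k ∂(μ i : Measure ℝ)) atTop
      (𝓝 (∫ z in Set.Iio c₀, z ^ k ∂(μ₀ : Measure ℝ))) := by
  set B' := max (max B (∫ z, z ^ (2 * k) ∂(μ₀ : Measure ℝ))) 0
  have hB'0 : 0 ≤ B' := le_max_right _ _
  rw [Metric.tendsto_atTop']
  -- Two cutoff errors ε(2B' + 1), one for each measure, plus ε for weak convergence.
  suffices h : ∀ ε > 0, ∀ᶠ i in atTop, |∫ z in Set.Iio (c i), z ^ k ∂(μ i : Measure ℝ) -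
      ∫ z in Set.Iio c₀, z ^ k ∂(μ₀ : Measure ℝ)| < ε * (4 * B' + 3) by
    intro ε hε
    have hD : 0 < 4 * B' + 3 := by positivity
    have := h (ε / (4 * B' + 3)) (by positivity)
    rw [div_mul_cancel₀ _ hD.ne'] at this
    obtain ⟨n, hn⟩ := eventually_atTop.1 this
    exact ⟨n, fun i hi => by rw [Real.dist_eq]; exact hn i hi.le⟩
  intro ε hε
  obtain ⟨R, η, hR, hη, hF⟩ := exists_cutoffSet_measure_lt c₀ hc₀
    (ε := ENNReal.ofReal (ε ^ 2)) (by positivity)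
  have hreal : ∀ ν : ProbabilityMeasure ℝ, (ν : Measure ℝ) (cutoffSet c₀ R η) <
      ENNReal.ofReal (ε ^ 2) → (ν : Measure ℝ).real (cutoffSet c₀ R η) ≤ ε ^ 2 := fun ν h =>
    ENNReal.toReal_le_of_le_ofReal (by positivity) h.le
  -- Portmanteau for a closed set: smallness under the limit law passes to all late laws.
  have h1 : ∀ᶠ i in atTop, (μ i : Measure ℝ) (cutoffSet c₀ R η) < ENNReal.ofReal (ε ^ 2) :=
    eventually_lt_of_limsup_lt ((ProbabilityMeasure.limsup_measure_closed_le_of_tendsto hμ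
      (isClosed_cutoffSet c₀ R η)).trans_lt hF)
  have h2 : Tendsto (fun i => ∫ z, cutoffPow k c₀ R η z ∂(μ i : Measure ℝ)) atTop
      (𝓝 (∫ z, cutoffPow k c₀ R η z ∂(μ₀ : Measure ℝ))) :=
    ProbabilityMeasure.tendsto_iff_forall_integral_tendsto.1 hμ
      (BoundedContinuousFunction.ofNormedAddCommGroup (cutoffPow k c₀ R η)
        (continuous_cutoffPow k c₀ R η) (R ^ k) (fun z => abs_cutoffPow_le hR k c₀ η z))
  have h3 : ∀ᶠ i in atTop, |c i - c₀| ≤ η :=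
    (Metric.tendsto_nhds.1 hc η hη).mono fun i hi => by rw [Real.dist_eq] at hi; exact hi.le
  have h0 := abs_setIntegral_sub_cutoffPow_le (μ := (μ₀ : Measure ℝ)) hR hη hε
    (c' := c₀)
    (by simpa using hη.le) (hint₀ k) (hint₀ (2 * k))
    (show _ ≤ B' from (le_max_right _ _).trans (le_max_left _ _)) (hreal μ₀ hF)
  filter_upwards [h1, h3, hB, Metric.tendsto_nhds.1 h2 ε hε] with i hi1 hi3 hiB hi2
  have hi := abs_setIntegral_sub_cutoffPow_le (μ := (μ i : Measure ℝ)) hR hη hε hi3 (hint i k)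
    (hint i (2 * k)) (show _ ≤ B' from (hiB.trans (le_max_left _ _)).trans (le_max_left _ _))
    (hreal (μ i) hi1)
  rw [Real.dist_eq] at hi2
  rw [abs_le] at h0 hi
  rw [abs_lt] at hi2 ⊢
  constructor <;> nlinarith

/-! ### Convergent sequences of polynomial functions -/

/-- Sequences of polynomial functions of bounded degree with convergent coefficients. -/
inductive PolyTendsto : (ℕ → ℝ → ℝ) → (ℝ → ℝ) → Prop
  | monomial (a : ℕ → ℝ) (a₀ : ℝ) (k : ℕ) (h : Tendsto a atTop (𝓝 a₀)) :
      PolyTendsto (fun i z => a i * z ^ k) (fun z => a₀ * z ^ k)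
  | add (f g : ℕ → ℝ → ℝ) (f₀ g₀ : ℝ → ℝ) (hf : PolyTendsto f f₀) (hg : PolyTendsto g g₀) :
      PolyTendsto (fun i z => f i z + g i z) (fun z => f₀ z + g₀ z)

theorem PolyTendsto.mul {f g : ℕ → ℝ → ℝ} {f₀ g₀ : ℝ → ℝ} (hf : PolyTendsto f f₀)
    (hg : PolyTendsto g g₀) : PolyTendsto (fun i z => f i z * g i z) (fun z => f₀ z * g₀ z) := by
  induction hf with
  | add f f' f₀ f₀' _ _ ih ih' => simpa only [add_mul] using ih.add _ _ _ _ ih'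
  | monomial a a₀ k ha =>
    induction hg with
    | add g g' g₀ g₀' _ _ ih ih' => simpa only [mul_add] using ih.add _ _ _ _ ih'
    | monomial b b₀ l hb =>
      convert! PolyTendsto.monomial (fun i => a i * b i) (a₀ * b₀) (k + l) (ha.mul hb) using 1
      · funext i z; ring
      · funext z; ring

theorem PolyTendsto.const_mul {f : ℕ → ℝ → ℝ} {f₀ : ℝ → ℝ} (hf : PolyTendsto f f₀) {a : ℕ → ℝ}
    {a₀ : ℝ} (ha : Tendsto a atTop (𝓝 a₀)) :
    PolyTendsto (fun i z => a i * f i z) (fun z => a₀ * f₀ z) := by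
  simpa using (PolyTendsto.monomial a a₀ 0 ha).mul hf

theorem PolyTendsto.id_mul {f : ℕ → ℝ → ℝ} {f₀ : ℝ → ℝ} (hf : PolyTendsto f f₀) :
    PolyTendsto (fun i z => z * f i z) (fun z => z * f₀ z) := by
  simpa using (PolyTendsto.monomial (fun _ => 1) 1 1 tendsto_const_nhds).mul hf

theorem PolyTendsto.tendsto_setIntegral {f : ℕ → ℝ → ℝ} {f₀ : ℝ → ℝ} (hf : PolyTendsto f f₀)
    {μ : ℕ → Measure ℝ} {μ₀ : Measure ℝ} {s : ℕ → Set ℝ} {s₀ : Set ℝ}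
    (hint : ∀ i j, Integrable (fun z => z ^ j) (μ i)) (hint₀ : ∀ j, Integrable (fun z => z ^ j) μ₀)
    (h : ∀ k, Tendsto (fun i => ∫ z in s i, z ^ k ∂μ i) atTop (𝓝 (∫ z in s₀, z ^ k ∂μ₀))) :
    Tendsto (fun i => ∫ z in s i, f i z ∂μ i) atTop (𝓝 (∫ z in s₀, f₀ z ∂μ₀)) := by
  -- Integrability is carried along the induction because additivity of the integral requires it.
  have key : (∀ i, Integrable (f i) (μ i)) ∧ Integrable f₀ μ₀ ∧
      Tendsto (fun i => ∫ z in s i, f i z ∂μ i) atTop (𝓝 (∫ z in s₀, f₀ z ∂μ₀)) := by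
    induction hf with
    | monomial a a₀ k ha =>
      refine ⟨fun i => (hint i k).const_mul _, (hint₀ k).const_mul _, ?_⟩
      simp only [integral_const_mul]
      exact ha.mul (h k)
    | add f g f₀ g₀ _ _ ihf ihg =>
      refine ⟨fun i => (ihf.1 i).fun_add (ihg.1 i), ihf.2.1.fun_add ihg.2.1, ?_⟩
      rw [integral_add ihf.2.1.integrableOn ihg.2.1.integrableOn]
      refine (ihf.2.2.add ihg.2.2).congr fun i => ?_
      rw [integral_add (ihf.1 i).integrableOn (ihg.1 i).integrableOn]
  exact key.2.2

end TruncatedMoments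

/-! ### Normalized Meixner and Hermite polynomials -/

section Limit

open ProbabilityTheory

/-- The off-diagonal recurrence coefficients of the normalized Meixner polynomials. -/
noncomputable def meixnerOffDiag (β ξ : ℝ) (x : ℕ) : ℝ :=
  √(x + 1) * (√(ξ * (x + β)) / √(ξ * β))

/-- The normalized Meixner polynomials in the standardized variable. -/
noncomputable def meixnerOrth (β ξ : ℝ) : ℕ → ℝ → ℝ
  | 0 => fun _ => 1
  | 1 => fun z => -(z * 1)
  | x + 2 => fun z => (meixnerOffDiag β ξ (x + 1))⁻¹ *
      (-1 * (z * meixnerOrth β ξ (x + 1) z) +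
        ((x + 1) * (1 + ξ) / √(ξ * β) * meixnerOrth β ξ (x + 1) z +
        -meixnerOffDiag β ξ x * meixnerOrth β ξ x z))

/-- This identity and its companion say that conjugation by √W turns the difference equation into a
symmetric (Jacobi) recurrence. -/
theorem meixnerOffDiag_mul_sqrt {β ξ : ℝ} (hβ : 0 < β) (hξ : 0 < ξ) (x : ℕ) :
    meixnerOffDiag β ξ x * √(meixnerWeight β ξ (x + 1)) =
      ξ * (x + β) / √(ξ * β) * √(meixnerWeight β ξ x) := by
  have h1 : √(meixnerWeight β ξ (x + 1)) * √(x + 1) =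
      √(ξ * (x + β)) * √(meixnerWeight β ξ x) := by
    rw [← Real.sqrt_mul (meixnerWeight_pos hβ hξ _).le, meixnerWeight_succ,
      Real.sqrt_mul (by positivity)]
  have h2 : √(ξ * (x + β)) * √(ξ * (x + β)) = ξ * (x + β) := Real.mul_self_sqrt (by positivity)
  rw [meixnerOffDiag]
  linear_combination (√(ξ * (x + β)) / √(ξ * β)) * h1 + √(meixnerWeight β ξ x) / √(ξ * β) * h2

theorem meixnerOffDiag_mul_sqrt' {β ξ : ℝ} (hβ : 0 < β) (hξ : 0 < ξ) (x : ℕ) :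
    meixnerOffDiag β ξ x * √(meixnerWeight β ξ x) =
      (x + 1) / √(ξ * β) * √(meixnerWeight β ξ (x + 1)) := by
  have h1 : √(meixnerWeight β ξ (x + 1)) * √(x + 1) =
      √(ξ * (x + β)) * √(meixnerWeight β ξ x) := by
    rw [← Real.sqrt_mul (meixnerWeight_pos hβ hξ _).le, meixnerWeight_succ,
      Real.sqrt_mul (by positivity)]
  have h2 : √((x : ℝ) + 1) * √(x + 1) = x + 1 := Real.mul_self_sqrt (by positivity)
  rw [meixnerOffDiag]
  linear_combination (-√((x : ℝ) + 1) / √(ξ * β)) * h1 +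
    √(meixnerWeight β ξ (x + 1)) / √(ξ * β) * h2

/-- The difference equation in x is read as a recurrence with index x; its eigenvalue parameter
(1-ξ)n = sz + ξβ, where s = √(ξβ), is affine in the standardized variable z. -/
theorem sqrt_meixnerWeight_mul_meixnerVal {β ξ : ℝ} (hβ : 0 < β) (hξ : 0 < ξ) (x n : ℕ) :
    √(meixnerWeight β ξ x) * meixnerVal β ξ n x = meixnerOrth β ξ x (meixnerStd β ξ n) := by
  set s := √(ξ * β) with hsdef
  have hs : 0 < s := Real.sqrt_pos.2 (mul_pos hξ hβ)
  have hs2 : s ^ 2 = ξ * β := Real.sq_sqrt (mul_pos hξ hβ).le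
  have hz : (1 - ξ) * n = s * meixnerStd β ξ n + ξ * β := by
    simp only [meixnerStd, ← hsdef]; field_simp; ring
  have hrec := fun x => meixnerVal_difference hβ hξ n x
  simp only [neg_mul, hz] at hrec
  have hA : ∀ x, meixnerOffDiag β ξ x ≠ 0 := fun x => by
    unfold meixnerOffDiag
    have : 0 < ξ * (x + β) := by positivity
    positivity
  have hW0 : meixnerWeight β ξ 0 = 1 := by simp [meixnerWeight]
  induction x using Nat.twoStepInduction with
  | zero => simp [meixnerOrth, hW0, meixnerVal_comm n, meixnerVal_zero_left]
  | one =>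
    have h0 := hrec 0
    have h1 := meixnerOffDiag_mul_sqrt hβ hξ 0
    have h2 : meixnerOffDiag β ξ 0 = 1 := by
      simp only [meixnerOffDiag, Nat.cast_zero, zero_add, Real.sqrt_one, one_mul]
      exact div_self hs.ne'
    have h3 : meixnerVal β ξ n 0 = 1 := by rw [meixnerVal_comm, meixnerVal_zero_left]
    rw [h2, hW0] at h1
    simp only [Nat.cast_zero, zero_add, one_mul, Real.sqrt_one, mul_one, h3,
      add_zero] at h0 h1
    simp only [meixnerOrth]
    rw [h1, ← hsdef]
    field_simp
    linear_combination h0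
  | more x ih0 ih1 =>
    have h0 := hrec (x + 1)
    have h1 := meixnerOffDiag_mul_sqrt hβ hξ (x + 1)
    have h2 := meixnerOffDiag_mul_sqrt' hβ hξ x
    rw [← hsdef] at h1 h2
    simp only [meixnerOrth]
    rw [eq_inv_mul_iff_mul_eq₀ (hA _), ← ih0, ← ih1, ← mul_assoc, ← hsdef]
    rw [Nat.add_sub_cancel] at h0
    push_cast at h0 h1
    rw [h1]
    have h3 : -meixnerOffDiag β ξ x * (√(meixnerWeight β ξ x) * meixnerVal β ξ n x) =
      -((x + 1) / s * √(meixnerWeight β ξ (x + 1))) * meixnerVal β ξ n x := by rw [← h2]; ring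
    rw [h3]
    field_simp
    linear_combination (√(meixnerWeight β ξ (x + 1))) * h0

/-- In each product of Meixner functions the squared factor √(W(n)/S) supplies the mass of the law
at n, and n < N becomes a half-line because standardization is increasing. -/
theorem meixnerKernel_eq_setIntegral {β ξ : ℝ} (hβ : 0 < β) (hξ : 0 < ξ) (hξ1 : ξ < 1)
    (N x y : ℕ) : meixnerKernel N β ξ x y = ∫ z in Set.Iio (meixnerStd β ξ N),
      meixnerOrth β ξ x z * meixnerOrth β ξ y z ∂meixnerLaw β ξ := by
  have hs : 0 < √(ξ * β) := Real.sqrt_pos.2 (mul_pos hξ hβ)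
  have hlt : ∀ n : ℕ, meixnerStd β ξ n < meixnerStd β ξ N ↔ n < N := fun n => by
    rw [meixnerStd, meixnerStd, div_lt_div_iff_of_pos_right hs, sub_lt_sub_iff_right,
      mul_lt_mul_iff_right₀ (by linarith), Nat.cast_lt]
  rw [← integral_indicator measurableSet_Iio, integral_meixnerLaw hβ hξ hξ1,
    meixnerKernel_eq_sum hβ hξ hξ1, tsum_eq_sum (s := Finset.range N)]
  · refine Finset.sum_congr rfl fun n hn => ?_
    have hn' : n < N := by simpa using hn
    rw [Set.indicator_of_mem (show _ ∈ Set.Iio _ from (hlt n).2 hn'),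
      ← sqrt_meixnerWeight_mul_meixnerVal hβ hξ, ← sqrt_meixnerWeight_mul_meixnerVal hβ hξ, smul_eq_mul]
    have := Real.mul_self_sqrt (meixnerWeight_div_nonneg hβ hξ hξ1 n)
    simp only [meixnerFun]
    linear_combination (√(meixnerWeight β ξ x) * meixnerVal β ξ n x *
      (√(meixnerWeight β ξ y) * meixnerVal β ξ n y)) * this
  · intro n hn
    rw [Set.indicator_of_notMem, smul_zero]
    rw [Set.mem_Iio, hlt]
    simpa using hn

/-! ### The Hermite side. -/

/-- The normalized Hermite polynomials in the reflected standard Gaussian variable. -/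
noncomputable def hermiteOrth (x : ℕ) (z : ℝ) : ℝ :=
  (√(2 ^ x * x !))⁻¹ * (hermiteH x).eval (-(z / √2))

theorem derivative_hermiteH (n : ℕ) :
    derivative (hermiteH (n + 1)) = C (2 * (n + 1 : ℝ)) * hermiteH n := by
  induction n with
  | zero => simpa [hermiteH] using (map_ofNat C 2).symm
  | succ n ih =>
    have h : hermiteH (n + 1 + 1) = 2 * X * hermiteH (n + 1) - derivative (hermiteH (n + 1)) := rfl
    have h' : hermiteH (n + 1) = 2 * X * hermiteH n - derivative (hermiteH n) := rfl
    rw [h, derivative_sub, derivative_mul, ih, derivative_C_mul]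
    have h2 : derivative (2 * X : ℝ[X]) = 2 := by simp
    have h3 : (C (2 * ((n + 1 : ℕ) + 1 : ℝ)) : ℝ[X]) = C (2 * (n + 1 : ℝ)) + 2 := by
      push_cast
      rw [mul_add 2 ((n : ℝ) + 1), C_add, mul_one, map_ofNat C 2]
    rw [h2, h3]
    linear_combination -(C (2 * (n + 1 : ℝ))) * h'

theorem hermiteH_recurrence (n : ℕ) (t : ℝ) : (hermiteH (n + 2)).eval t =
    2 * t * (hermiteH (n + 1)).eval t - 2 * (n + 1) * (hermiteH n).eval t := by
  have h : hermiteH (n + 2) = 2 * X * hermiteH (n + 1) - derivative (hermiteH (n + 1)) := rfl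
  rw [h, derivative_hermiteH]
  simp

/-- Shaped exactly like the recursion of `meixnerOrth`, with its coefficients replaced by their
limits: diagonal 0, off-diagonal √(x+1). -/
theorem hermiteOrth_add_two (x : ℕ) (z : ℝ) : hermiteOrth (x + 2) z =
    (√((x + 1 : ℕ) + 1))⁻¹ * (-1 * (z * hermiteOrth (x + 1) z) +
      (0 * hermiteOrth (x + 1) z + -√(x + 1) * hermiteOrth x z)) := by
  have e1 : √((2 : ℝ) ^ (x + 1) * (x + 1)!) = √2 * √(x + 1) * √(2 ^ x * x !) := by
    rw [← Real.sqrt_mul (by positivity), ← Real.sqrt_mul (by positivity), Nat.factorial_succ]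
    congr 1; push_cast; ring
  have e2 : √((2 : ℝ) ^ (x + 2) * (x + 2)!) =
      √2 * √((x + 1 : ℕ) + 1) * (√2 * √(x + 1) * √(2 ^ x * x !)) := by
    rw [← e1, ← Real.sqrt_mul (by positivity), ← Real.sqrt_mul (by positivity), Nat.factorial_succ]
    congr 1; push_cast; ring
  have h0 : 0 < √((2 : ℝ) ^ x * x !) := by positivity
  have h1 : 0 < √((x : ℝ) + 1) := by positivity
  have h2 : 0 < √(((x + 1 : ℕ) : ℝ) + 1) := by positivity
  have h3 : √((x : ℝ) + 1) ^ 2 = x + 1 := Real.sq_sqrt (by positivity)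
  have h4 : √(2 : ℝ) ^ 2 = 2 := Real.sq_sqrt (by positivity)
  simp only [hermiteOrth]
  rw [hermiteH_recurrence, e1, e2]
  set a := √((2 : ℝ) ^ x * x !)
  set b := √((x : ℝ) + 1)
  set c := √(((x + 1 : ℕ) : ℝ) + 1)
  set d := √(2 : ℝ)
  have hd : 0 < d := by positivity
  rw [← h3]
  field_simp
  rw [h4]
  ring

theorem hermiteOrth_zero (z : ℝ) : hermiteOrth 0 z = 1 := by simp [hermiteOrth, hermiteH]

theorem hermiteOrth_one (z : ℝ) : hermiteOrth 1 z = -z := by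
  have h4 : √(2 : ℝ) ^ 2 = 2 := Real.sq_sqrt (by positivity)
  simp [hermiteOrth, hermiteH]
  field_simp
  rw [h4]

theorem polyTendsto_meixnerOrth {β ξ : ℕ → ℝ} (hβ : ∀ i, 0 < β i) (hξ : ∀ i, 0 < ξ i)
    (hξ1 : ∀ i, ξ i < 1) (h : Tendsto (fun i => √(ξ i * β i)) atTop atTop) (x : ℕ) :
    PolyTendsto (fun i => meixnerOrth (β i) (ξ i) x) (hermiteOrth x) := by
  have hinv : Tendsto (fun i => (√(ξ i * β i))⁻¹) atTop (𝓝 0) := h.inv_tendsto_atTop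
  have hratio : ∀ x : ℕ, Tendsto (fun i => meixnerOffDiag (β i) (ξ i) x) atTop
      (𝓝 (√(x + 1))) := fun x => by
    -- The off-diagonal coefficient is √(x+1)·√(1 + x/β), and β > ξβ → ∞.
    have h1 : Tendsto (fun i => 1 + x * (β i)⁻¹) atTop (𝓝 (1 + x * 0)) := by
      refine (Tendsto.const_mul _ ?_).const_add _
      have h2 : Tendsto (fun i => (√(ξ i * β i))⁻¹ ^ 2) atTop (𝓝 (0 ^ 2)) := hinv.pow 2
      rw [zero_pow two_ne_zero] at h2
      refine squeeze_zero (fun i => (inv_pos.2 (hβ i)).le) (fun i => ?_) h2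
      rw [inv_pow, Real.sq_sqrt (mul_pos (hξ i) (hβ i)).le]
      have := mul_pos (hξ i) (hβ i)
      gcongr
      nlinarith [hβ i, hξ1 i]
    have h3 := (h1.sqrt).const_mul (√((x : ℝ) + 1))
    rw [mul_zero, add_zero, Real.sqrt_one, mul_one] at h3
    refine h3.congr fun i => ?_
    have := hβ i
    have := hξ i
    rw [meixnerOffDiag, ← Real.sqrt_div (by positivity)]
    congr 2
    field_simp
    ring
  have hone : PolyTendsto (fun _ _ => 1) (fun _ => 1) := by
    simpa using PolyTendsto.monomial (fun _ => 1) 1 0 tendsto_const_nhds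
  induction x using Nat.twoStepInduction with
  | zero =>
    have : hermiteOrth 0 = fun _ => 1 := funext hermiteOrth_zero
    rw [this]
    exact hone
  | one =>
    have : hermiteOrth 1 = fun z => -(z * 1) := funext fun z => by rw [hermiteOrth_one, mul_one]
    rw [this]
    simpa [meixnerOrth] using hone.id_mul.const_mul (a := fun _ => -1) tendsto_const_nhds
  | more x ih0 ih1 =>
    rw [show hermiteOrth (x + 2) = _ from funext (hermiteOrth_add_two x)]
    refine PolyTendsto.const_mul (PolyTendsto.add _ _ _ _
      (ih1.id_mul.const_mul tendsto_const_nhds) (PolyTendsto.add _ _ _ _ (ih1.const_mul ?_)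
        (ih0.const_mul (hratio x).neg))) ((hratio (x + 1)).inv₀ (by positivity))
    refine squeeze_zero (fun i => ?_) (fun i => ?_)
      (by simpa using hinv.const_mul (((x : ℝ) + 1) * 2))
    · have := hξ i
      positivity
    · rw [div_eq_mul_inv]
      have := hξ1 i
      gcongr
      linarith

/-- The substitution z = -√2 t, which reverses the half-line and turns e^{-t²} into the Gaussian
density. -/
theorem discreteHermiteKernel_eq_setIntegral (r : ℝ) (x y : ℕ) :
    discreteHermiteKernel r x y = ∫ z in Set.Iio (-(√2 * r)),
      hermiteOrth x z * hermiteOrth y z ∂gaussianReal 0 1 := by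
  have hd : (0 : ℝ) < √2 := by positivity
  have h4 : √(2 : ℝ) ^ 2 = 2 := Real.sq_sqrt (by positivity)
  rw [← integral_indicator measurableSet_Iio, integral_gaussianReal_eq_integral_smul one_ne_zero]
  set G : ℝ → ℝ := fun z => gaussianPDFReal 0 1 z • (Set.Iio (-(√2 * r))).indicator
    (fun z => hermiteOrth x z * hermiteOrth y z) z
  have h1 := Measure.integral_comp_mul_left G (-√2)
  have h2 : ∫ z, G z = √2 * ∫ t, G (-√2 * t) := by
    rw [h1, smul_eq_mul, abs_inv, abs_neg, abs_of_pos hd, mul_inv_cancel_left₀ hd.ne']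
  change _ = ∫ z, G z
  rw [h2, discreteHermiteKernel, ← integral_indicator measurableSet_Ioi, ← integral_const_mul,
    ← integral_const_mul]
  refine integral_congr_ae (.of_forall fun t => ?_)
  simp only [G]
  by_cases ht : r < t
  · have hz : -√2 * t ∈ Set.Iio (-(√2 * r)) := by
      rw [Set.mem_Iio]; nlinarith
    have hz2 : -(-√2 * t / √2) = t := by field_simp
    rw [Set.indicator_of_mem hz, Set.indicator_of_mem (show t ∈ Set.Ioi r from ht)]
    simp only [hermiteOrth, hz2, gaussianPDFReal, smul_eq_mul]
    have e1 : √(Real.pi * 2 ^ (x + y) * (x ! : ℝ) * (y ! : ℝ)) =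
        √Real.pi * (√(2 ^ x * x !) * √(2 ^ y * y !)) := by
      rw [← Real.sqrt_mul (by positivity), ← Real.sqrt_mul (by positivity)]
      congr 1; ring
    have e2 : √(2 * Real.pi * ((1 : NNReal) : ℝ)) = √2 * √Real.pi := by
      rw [NNReal.coe_one, mul_one, Real.sqrt_mul (by positivity)]
    have e3 : -(-√2 * t - 0) ^ 2 / (2 * ((1 : NNReal) : ℝ)) = -t ^ 2 := by
      rw [NNReal.coe_one, sub_zero, mul_pow, neg_sq, h4]; ring
    rw [e1, e2, e3]
    have := Real.sqrt_pos.2 Real.pi_pos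
    field_simp
  · have hz : -√2 * t ∉ Set.Iio (-(√2 * r)) := by
      rw [Set.mem_Iio]; nlinarith
    rw [Set.indicator_of_notMem hz, Set.indicator_of_notMem (show t ∉ Set.Ioi r from ht)]
    simp

/-! ### Convergence of the kernels and conclusion. -/

theorem tendsto_meixnerKernel {r : ℝ} {β ξ : ℕ → ℝ} {N : ℕ → ℕ} (hβ : ∀ i, 0 < β i)
    (hξ : ∀ i, 0 < ξ i) (hξ1 : ∀ i, ξ i < 1)
    (h₁ : Tendsto (fun i => ξ i * β i) atTop atTop)
    (h₂ : Tendsto (fun i => -√(ξ i * β i) + (1 - ξ i) * (N i : ℝ) / √(ξ i * β i)) atTop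
      (𝓝 (-(√2 * r)))) (x y : ℕ) :
    Tendsto (fun i => meixnerKernel (N i) (β i) (ξ i) x y) atTop
      (𝓝 (discreteHermiteKernel r x y)) := by
  have hs : Tendsto (fun i => √(ξ i * β i)) atTop atTop := Real.tendsto_sqrt_atTop.comp h₁
  have hc : Tendsto (fun i => meixnerStd (β i) (ξ i) (N i)) atTop (𝓝 (-(√2 * r))) := by
    refine h₂.congr fun i => ?_
    have h1 : 0 < ξ i * β i := mul_pos (hξ i) (hβ i)
    have h2 : 0 < √(ξ i * β i) := Real.sqrt_pos.2 h1
    have h3 := Real.sq_sqrt h1.le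
    rw [meixnerStd, eq_div_iff h2.ne']
    field_simp
    linear_combination -h3
  let μ : ℕ → ProbabilityMeasure ℝ := fun i =>
    ⟨meixnerLaw (β i) (ξ i), isProbabilityMeasure_meixnerLaw (hβ i) (hξ i) (hξ1 i)⟩
  let μ₀ : ProbabilityMeasure ℝ := ⟨gaussianReal 0 1, inferInstance⟩
  have hμ : Tendsto μ atTop (𝓝 μ₀) := ProbabilityMeasure.tendsto_iff_tendsto_charFun.2
    (tendsto_charFun_meixnerLaw hβ hξ hξ1 hs)
  have hint : ∀ i j, Integrable (fun z => z ^ j) (μ i : Measure ℝ) := fun i j =>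
    integrable_pow_meixnerLaw (hβ i) (hξ i) (hξ1 i) j
  have hint₀ : ∀ j, Integrable (fun z => z ^ j) (μ₀ : Measure ℝ) := fun j =>
    (memLp_id_gaussianReal (j : NNReal)).integrable_norm_pow'.mono' (by fun_prop)
      (.of_forall fun z => by simp)
  simp only [meixnerKernel_eq_setIntegral (hβ _) (hξ _) (hξ1 _),
    discreteHermiteKernel_eq_setIntegral]
  refine ((polyTendsto_meixnerOrth hβ hξ hξ1 hs x).mul
    (polyTendsto_meixnerOrth hβ hξ hξ1 hs y)).tendsto_setIntegral (μ := fun i => (μ i : Measure ℝ))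
    (μ₀ := (μ₀ : Measure ℝ)) hint hint₀ fun k => ?_
  obtain ⟨B, hB⟩ := exists_bound_moment_meixnerLaw (2 * k)
  refine tendsto_setIntegral_pow hμ hc ?_ k hint hint₀ (B := B) ?_
  · have := nullSingletonClass_gaussianReal (μ := 0) (v := 1) one_ne_zero
    change gaussianReal 0 1 {-(√2 * r)} = 0
    exact measure_singleton _
  · filter_upwards [hs.eventually_ge_atTop 1] with i hi
    exact (le_abs_self _).trans (hB _ _ (hβ i) (hξ i) (hξ1 i) hi)

end Limit

theorem mainTheorem9 (r : ℝ) (β ξ : ℕ → ℝ)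
    (hβ : ∀ N : ℕ, 1 ≤ N → 0 < β N)
    (hξ : ∀ N : ℕ, 1 ≤ N → 0 < ξ N ∧ ξ N < 1)
    (h₁ : Tendsto (fun N : ℕ => ξ N * β N) atTop atTop)
    (h₂ : Tendsto
      (fun N : ℕ => -√(ξ N * β N) + (1 - ξ N) * (N : ℝ) / √(ξ N * β N)) atTop
      (𝓝 (-(√2 * r)))) :
    (∀ N : ℕ, 1 ≤ N →
      ∃! P : ProbabilityMeasure Conf, IsDeterminantal (meixnerKernel N (β N) (ξ N)) P) ∧
    (∃! P : ProbabilityMeasure Conf, IsDeterminantal (discreteHermiteKernel r) P) ∧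
    Tendsto (fun N : ℕ => meixnerEnsemble N (β N) (ξ N)) atTop
      (𝓝 (discreteHermiteEnsemble r)) := by
  have hex : ∀ N, IsDeterminantal (meixnerKernel N (β N) (ξ N)) (meixnerEnsemble N (β N) (ξ N)) :=
    fun N => Classical.epsilon_spec (exists_isDeterminantal_orthPolyKernel _ N)
  -- The positivity assumptions start at N = 1, hence the shift of the index by one.
  have hK := tendsto_meixnerKernel (r := r) (β := fun i => β (i + 1)) (ξ := fun i => ξ (i + 1))
    (N := fun i => i + 1) (fun i => hβ _ (by omega)) (fun i => (hξ _ (by omega)).1)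
    (fun i => (hξ _ (by omega)).2) (h₁.comp (tendsto_add_atTop_nat 1))
    (h₂.comp (tendsto_add_atTop_nat 1))
  -- One compactness argument yields both the existence of DH⁺(r) and the convergence to it.
  obtain ⟨Q, hQ, hlim⟩ := exists_isDeterminantal_of_tendsto (K := discreteHermiteKernel r)
    (fun N => meixnerEnsemble N (β N) (ξ N)) fun Y => by
      simp only [hex _ Y]
      exact tendsto_det_of_tendsto (fun x y => (tendsto_add_atTop_iff_nat 1).1 (hK x y)) Y
  refine ⟨fun N _ => ⟨_, hex N, fun P hP => hP.unique (hex N)⟩,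
    ⟨Q, hQ, fun P hP => hP.unique hQ⟩, ?_⟩
  rw [discreteHermiteEnsemble, hQ.determinantalMeasure_eq]
  exact hlim
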